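/- Let $d\ge 1$ and let $g:\mathbb R^d\to\mathbb R$ be bounded and continuous with $\inf_{x\in\mathbb R^d}|g(x)-1|>0$. Put $I=\inf_{\mathbb R^d} g$, $S=\sup_{\mathbb R^d} g$, and consider the problem $$\partial_t u=\Delta u+\zeta(u)\quad (t>0,\ x\in\mathbb R^d),\qquad u(0,\cdot)=g, \tag{1}$$ where $\zeta$ is the Riemann zeta function. Let $Y$ be the space of bounded continuous functions $\mathbb R^d\to\mathbb C$ with the sup norm, and let $K_t(x)=(4\pi t)^{-d/2}e^{-|x|^2/(4t)}$. For $0<T\le\infty$, a solution of (1) on $[0,T)$ is a map $u:[0,T)\to Y$ with $u(0)=g$ such that: $u$ is norm continuous on $(0,T)$; $u(t)\to g$ locally uniformly as $t\downarrow0$; for every $T'<T$ one has $\sup_{[0,T']\times\mathbb R^d}|u|<\infty$ and $\inf_{[0,T']\times\mathbb R^d}|u-1|>0$; and Duhamel's formula $$u(t,x)=\int_{\mathbb R^d}K_t(x-y)g(y)\,dy+\int_0^t\int_{\mathbb R^d}K_{t-s}(x-y)\,\zeta(u(s,y))\,dy\,ds$$ holds for all $t\in(0,T)$, $x\in\mathbb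 R^d$. Then (1) has a solution $u$ on $[0,\infty)$, and every solution on an interval $[0,T)$ coincides with $u$ there. The solution $u$ is real-valued, and if $g$ is uniformly continuous then $u\in C([0,\infty);Y)$. Moreover: 1. If $I>1$, then $t+I\le u(t,x)\le \zeta(I)\,t+S$ for all $t\ge0$, $x\in\mathbb R^d$. 2. If $I<1$, then $-2k_1\le u(t,x)\le -2k_2$ for all $t\ge 0$, $x\in\mathbb R^d$, where $-2k_1=\max\{-2k\le I: k=1,2,3,\dots\}$, and where $-2k_2=\min\{-2k\ge S: k=1,2,3,\dots\}$ if $S\le-2$, while $-2k_2$ denotes the number $S$ itself if $S>-2$. 3. If $I<1$ and $n_1,n_2$ are positive integers with $I\in(-4n_1,-4n_1+4)$ and $S\in(-4n_2,-4n_2+4)$, then for every $x\in\mathbb R^d$ $$-4n_1+2\le\liminf_{t\to\infty}u(t,x)\le\limsup_{t\to\infty}u(t,x)\le-4n_2+2 .$$ -/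

import Mathlib

open MeasureTheory Filter Topology Set
open scoped BoundedContinuousFunction

/-- The heat kernel `K_t(x) = (4πt)^{-d/2} exp(-|x|²/(4t))` on `ℝ^d` (used for `t > 0`). -/
noncomputable def heatKernel (d : ℕ) (t : ℝ) (x : EuclideanSpace ℝ (Fin d)) : ℝ :=
  (4 * Real.pi * t) ^ (-(d : ℝ) / 2) * Real.exp (-‖x‖ ^ 2 / (4 * t))

/-- `u` is a bounded continuous solution, in the Duhamel sense, on the time interval `[0, T)` of
`∂ₜ u = Δu + ζ(u)`, `u(0) = g`, with values in the space of bounded continuous functions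
`ℝ^d → ℂ` with the sup norm. The heat semigroup is norm continuous up to `t = 0` only on
uniformly continuous data, so continuity at `t = 0` is required locally uniformly in space. -/
structure IsZetaHeatSolution {d : ℕ} (g : EuclideanSpace ℝ (Fin d) →ᵇ ℂ) (T : ℝ)
    (u : ℝ → (EuclideanSpace ℝ (Fin d) →ᵇ ℂ)) : Prop where
  /-- The initial condition. -/
  initial : u 0 = g
  /-- Norm continuity at positive times. -/
  continuousOn : ContinuousOn u (Ioo 0 T)
  /-- Continuity at the initial time. -/
  tendsto_initial : TendstoLocallyUniformly (fun t x => u t x) (fun x => g x) (𝓝[>] 0)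
  /-- Up to any time before `T`, the solution is bounded and stays away from the pole `1`. -/
  bounded_and_away : ∀ T' : ℝ, T' < T → ∃ β ε : ℝ, 0 < ε ∧
    ∀ t ∈ Icc 0 T', ∀ x, ‖u t x‖ ≤ β ∧ ε ≤ ‖u t x - 1‖
  /-- Duhamel's formula `u(t) = e^{tΔ} g + ∫₀ᵗ e^{(t-s)Δ} ζ(u(s)) ds`. -/
  duhamel : ∀ t ∈ Ioo 0 T, ∀ x, u t x =
    (∫ y, (heatKernel d t (x - y) : ℂ) * g y) +
      ∫ s in (0 : ℝ)..t, ∫ y, (heatKernel d (t - s) (x - y) : ℂ) * riemannZeta (u s y)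

/-- A real-valued bounded continuous function, regarded as a complex-valued one. -/
noncomputable def complexify {d : ℕ} (g : EuclideanSpace ℝ (Fin d) →ᵇ ℝ) :
    EuclideanSpace ℝ (Fin d) →ᵇ ℂ :=
  BoundedContinuousFunction.ofNormedAddCommGroup (fun x => (g x : ℂ))
    (Complex.continuous_ofReal.comp g.continuous) ‖g‖
    (fun x => by simpa using g.norm_coe_le_norm x)

/-- `-2k₁ = max {-2k ≤ I | k = 1, 2, 3, …}` (the set is nonempty and the maximum is attained). -/
noncomputable def lowerTrivialZero (I : ℝ) : ℝ :=
  sSup {z : ℝ | (∃ k : ℕ, 1 ≤ k ∧ z = -2 * (k : ℝ)) ∧ z ≤ I}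

open Classical in
/-- `-2k₂`: the number `inf {-2k ≥ S | k = 1, 2, 3, …}` if `S ≤ -2` (a finite nonempty set),
and by convention the number `S` itself if `S > -2`. -/
noncomputable def upperBarrier (S : ℝ) : ℝ :=
  if S ≤ -2 then sInf {z : ℝ | (∃ k : ℕ, 1 ≤ k ∧ z = -2 * (k : ℝ)) ∧ S ≤ z} else S

/-! Since `ℝ^d` is connected, `g` stays on one side of the pole. On the range that the solution will
occupy, `ζ` agrees with a globally Lipschitz `F`: `ζ(max x I)` above the pole, and `ζ` composed with
the projection onto `[-2k₁, -2k₂]` below it. For such `F` a global solution comes from a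
contraction, and spatially constant barriers confine it to the range where `F = ζ`.

Comparison needs no differentiability of `u`. If `L` is a Lipschitz constant of `F`, then `x ↦ F x +
L x` is monotone, so the Duhamel operator of `∂ₜu = (Δ - L)u + (F(u) + Lu)` preserves order. A bound
`u - φ ≤ m e^{4Ls}` therefore improves to the same bound with `m/2`, and iteration gives `u ≤ φ`
(`IsShiftedMild.le_of_supersolution`). The damping is removed afterwards in `IsShiftedMild.duhamel`.

The barriers reflect the graph of `ζ`. Above the pole `1 ≤ ζ ≤ ζ(I)` on `[I, ∞)`, which gives the
two affine bounds. Below it the trivial zeros are equilibria and `ζ < 0` on `(-2, 1)`. Moreover `ζ >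
0` on `(-4n, -4n+2)` and `ζ < 0` on `(-4n+2, -4n+4)`, so exponentially relaxing barriers push the
solution towards `-4n+2`. The signs come from the functional equation for `x < 0` and from the
fractional-part integral on `(0, 1)`.

The heat semigroup is handled as `∫ f(x - √τ z) dμ(z)` with one fixed Gaussian `μ`; this form is not
singular at `τ = 0`. Uniqueness must cover complex-valued competitors, so it is proved separately,
by a halving argument on a compact set avoiding `1`. -/

/-! ### The heat semigroup as a Gaussian average -/

theorem continuous_heatKernel (d : ℕ) (t : ℝ) : Continuous (heatKernel d t) := by
  unfold heatKernel; fun_prop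

theorem heatKernel_pos (d : ℕ) {t : ℝ} (ht : 0 < t) (x : EuclideanSpace ℝ (Fin d)) :
    0 < heatKernel d t x := by
  unfold heatKernel
  have := Real.pi_pos
  positivity

theorem integral_cexp_neg_sq_norm_add (d : ℕ) (w : EuclideanSpace ℝ (Fin d)) :
    ∫ x, (heatKernel d 1 x : ℂ) * Complex.exp (inner ℝ x w * Complex.I) =
      Complex.exp (-(‖w‖ : ℂ) ^ 2) := by
  have hb : 0 < ((1 / 4 : ℂ)).re := by norm_num
  have h := GaussianFourier.integral_cexp_neg_mul_sq_norm_add hb Complex.I w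
  have hpi := Real.pi_pos
  have h1 : ∀ x : EuclideanSpace ℝ (Fin d),
      (heatKernel d 1 x : ℂ) * Complex.exp (inner ℝ x w * Complex.I) =
      (((4 * Real.pi) ^ (-(d : ℝ) / 2) : ℝ) : ℂ) *
        Complex.exp (-(1 / 4 : ℂ) * ‖x‖ ^ 2 + Complex.I * inner ℝ w x) := by
    intro x
    rw [heatKernel, Complex.ofReal_mul, mul_assoc, mul_one, Complex.ofReal_exp, ← Complex.exp_add,
      real_inner_comm]
    congr 2
    push_cast
    ring
  simp_rw [h1]
  rw [integral_const_mul, h, ← mul_assoc]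
  have h2 : ((Real.pi : ℂ) / (1 / 4)) ^ ((Module.finrank ℝ (EuclideanSpace ℝ (Fin d)) : ℂ) / 2) =
      (((4 * Real.pi) ^ ((d : ℝ) / 2) : ℝ) : ℂ) := by
    rw [Complex.ofReal_cpow (by positivity)]
    simp
    congr 1
    ring
  rw [h2, ← Complex.ofReal_mul, ← Real.rpow_add (by positivity)]
  simp [neg_div]

theorem integrable_heatKernel_one (d : ℕ) : Integrable (heatKernel d 1) := by
  have h := GaussianFourier.integrable_cexp_neg_mul_sq_norm_add (V := EuclideanSpace ℝ (Fin d))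
    (b := 1 / 4) (by norm_num) 0 0
  have h2 := (h.norm).const_mul ((4 * Real.pi * 1) ^ (-(d : ℝ) / 2))
  refine h2.congr (Eventually.of_forall fun x => ?_)
  simp only [heatKernel]
  congr 1
  rw [Complex.norm_exp]
  congr 1
  rw [zero_mul, add_zero, show (-(1 / 4 : ℂ) * (‖x‖ : ℂ) ^ 2) = ((-(1 / 4) * ‖x‖ ^ 2 : ℝ) : ℂ) by
    push_cast; ring, Complex.ofReal_re]
  ring

theorem integral_heatKernel_one (d : ℕ) : ∫ x, heatKernel d 1 x = 1 := by
  have h := integral_cexp_neg_sq_norm_add d 0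
  simp only [inner_zero_right, Complex.ofReal_zero, zero_mul, Complex.exp_zero, mul_one, norm_zero]
    at h
  rw [integral_complex_ofReal] at h
  simpa using h

/-- The centred Gaussian measure with density `heatKernel d 1`. -/
noncomputable def heatMeasure (d : ℕ) : Measure (EuclideanSpace ℝ (Fin d)) :=
  volume.withDensity fun x => ENNReal.ofReal (heatKernel d 1 x)

instance isProbabilityMeasure_heatMeasure (d : ℕ) : IsProbabilityMeasure (heatMeasure d) := by
  constructor
  rw [heatMeasure, withDensity_apply _ MeasurableSet.univ, setLIntegral_univ,
    ← ofReal_integral_eq_lintegral_ofReal (integrable_heatKernel_one d)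
      (Eventually.of_forall fun x => (heatKernel_pos d one_pos x).le),
    integral_heatKernel_one, ENNReal.ofReal_one]

theorem integral_heatMeasure {V : Type*} [NormedAddCommGroup V] [NormedSpace ℝ V] (d : ℕ)
    (f : EuclideanSpace ℝ (Fin d) → V) :
    ∫ z, f z ∂(heatMeasure d) = ∫ z, heatKernel d 1 z • f z := by
  rw [heatMeasure, integral_withDensity_eq_integral_toReal_smul
    ((continuous_heatKernel d 1).measurable.ennreal_ofReal)
    (Eventually.of_forall fun x => ENNReal.ofReal_lt_top)]
  simp_rw [ENNReal.toReal_ofReal (heatKernel_pos d one_pos _).le]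

theorem charFun_heatMeasure (d : ℕ) (w : EuclideanSpace ℝ (Fin d)) :
    charFun (heatMeasure d) w = Complex.exp (-(‖w‖ : ℂ) ^ 2) := by
  rw [charFun_apply, integral_heatMeasure, ← integral_cexp_neg_sq_norm_add]
  simp

/-- The image under `√c` has characteristic function `exp(-c‖w‖²)`, and these multiply correctly.
This is the semigroup law at the level of measures. -/
theorem conv_map_smul_heatMeasure (d : ℕ) {a b : ℝ} (ha : 0 ≤ a) (hb : 0 ≤ b) :
    ((heatMeasure d).map (√a • ·)).conv ((heatMeasure d).map (√b • ·)) =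
      (heatMeasure d).map (√(a + b) • ·) := by
  have hp : ∀ r : ℝ, IsProbabilityMeasure ((heatMeasure d).map (r • ·)) := fun r =>
    Measure.isProbabilityMeasure_map (by fun_prop)
  have h1 := hp √a
  have h2 := hp √b
  have h3 := hp √(a + b)
  refine Measure.ext_of_charFun (funext fun w => ?_)
  rw [charFun_conv]
  simp only [charFun_map_smul, charFun_heatMeasure]
  rw [← Complex.exp_add]
  congr 1
  simp only [norm_smul, Real.norm_of_nonneg (Real.sqrt_nonneg _)]
  have : ∀ c : ℝ, 0 ≤ c → (((√c * ‖w‖ : ℝ)) : ℂ) ^ 2 = c * (‖w‖ : ℂ) ^ 2 := by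
    intro c hc
    rw [← Complex.ofReal_pow, mul_pow, Real.sq_sqrt hc]; push_cast; rfl
  rw [this a ha, this b hb, this _ (by positivity)]
  push_cast; ring

/-- The heat semigroup `e^{τΔ}`, written as an average over the Gaussian measure. -/
noncomputable def heatOp {V : Type*} [NormedAddCommGroup V] [NormedSpace ℝ V] (d : ℕ) (τ : ℝ)
    (f : EuclideanSpace ℝ (Fin d) → V) (x : EuclideanSpace ℝ (Fin d)) : V :=
  ∫ z, f (x - √τ • z) ∂(heatMeasure d)

theorem integrable_comp_sub_smul {V : Type*} [NormedAddCommGroup V] {d : ℕ}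
    {f : EuclideanSpace ℝ (Fin d) → V} (hf : Continuous f) {C : ℝ}
    (hC : ∀ y, ‖f y‖ ≤ C) (τ : ℝ) (x : EuclideanSpace ℝ (Fin d)) :
    Integrable (fun z => f (x - √τ • z)) (heatMeasure d) := by
  refine Integrable.of_bound (hf.comp (by fun_prop)).aestronglyMeasurable C ?_
  exact Eventually.of_forall fun z => hC _

section heatOp

variable {V : Type*} [NormedAddCommGroup V] [NormedSpace ℝ V] {d : ℕ}

theorem heatKernel_smul {t : ℝ} (ht : 0 < t) (z : EuclideanSpace ℝ (Fin d)) :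
    heatKernel d t (√t • z) = t ^ (-(d : ℝ) / 2) * heatKernel d 1 z := by
  unfold heatKernel
  rw [norm_smul, Real.norm_of_nonneg (Real.sqrt_nonneg _), mul_pow, Real.sq_sqrt ht.le, mul_one,
    mul_one, Real.mul_rpow (by positivity) ht.le]
  rw [show -(t * ‖z‖ ^ 2) / (4 * t) = -‖z‖ ^ 2 / 4 by field_simp]
  ring

/-- The substitution `y = x - √t z`; its Jacobian cancels the factor `t^{-d/2}` of the kernel. -/
theorem integral_heatKernel_smul {t : ℝ} (ht : 0 < t) (f : EuclideanSpace ℝ (Fin d) → V)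
    (x : EuclideanSpace ℝ (Fin d)) :
    ∫ y, heatKernel d t (x - y) • f y = heatOp d t f x := by
  have h1 : ∫ y, heatKernel d t (x - y) • f y = ∫ y, heatKernel d t y • f (x - y) := by
    rw [← integral_sub_left_eq_self (fun y => heatKernel d t (x - y) • f y) volume x]
    simp
  have h2 := Measure.integral_comp_smul volume (fun y => heatKernel d t y • f (x - y)) (√t)
  rw [h1, heatOp, integral_heatMeasure]
  have hs : 0 < √t := Real.sqrt_pos.mpr ht
  have h3 : |(√t ^ Module.finrank ℝ (EuclideanSpace ℝ (Fin d)))⁻¹| = t ^ (-(d : ℝ) / 2) := by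
    rw [abs_of_pos (by positivity), finrank_euclideanSpace_fin, Real.sqrt_eq_rpow,
      ← Real.rpow_natCast, ← Real.rpow_mul ht.le, ← Real.rpow_neg ht.le]
    congr 1; ring
  rw [h3] at h2
  simp_rw [heatKernel_smul ht, mul_smul] at h2
  rw [integral_smul] at h2
  exact (smul_right_injective V (by positivity : t ^ (-(d : ℝ) / 2) ≠ 0) h2).symm

theorem integral_heatKernel_mul_ofReal {t : ℝ} (ht : 0 < t) (f : EuclideanSpace ℝ (Fin d) → ℂ)
    (x : EuclideanSpace ℝ (Fin d)) :
    ∫ y, (heatKernel d t (x - y) : ℂ) * f y = heatOp d t f x := by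
  simpa [Complex.real_smul] using integral_heatKernel_smul ht f x

theorem heatOp_zero (f : EuclideanSpace ℝ (Fin d) → V) (x : EuclideanSpace ℝ (Fin d)) [CompleteSpace V] :
    heatOp d 0 f x = f x := by
  simp [heatOp]

theorem norm_heatOp_le {f : EuclideanSpace ℝ (Fin d) → V} {C : ℝ} (hC : ∀ y, ‖f y‖ ≤ C) (τ : ℝ)
    (x : EuclideanSpace ℝ (Fin d)) : ‖heatOp d τ f x‖ ≤ C := by
  have := norm_integral_le_of_norm_le_const (μ := heatMeasure d) (f := fun z => f (x - √τ • z))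
    (Eventually.of_forall fun z => hC _)
  simpa [heatOp] using this

theorem heatOp_sub {f g : EuclideanSpace ℝ (Fin d) → V} (hf : Continuous f) (hg : Continuous g)
    {C C' : ℝ} (hC : ∀ y, ‖f y‖ ≤ C) (hC' : ∀ y, ‖g y‖ ≤ C') (τ : ℝ)
    (x : EuclideanSpace ℝ (Fin d)) :
    heatOp d τ (fun y => f y - g y) x = heatOp d τ f x - heatOp d τ g x :=
  integral_sub (integrable_comp_sub_smul hf hC τ x) (integrable_comp_sub_smul hg hC' τ x)

theorem heatOp_le {f : EuclideanSpace ℝ (Fin d) → ℝ} (hf : Continuous f)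
    {C m : ℝ} (hC : ∀ y, ‖f y‖ ≤ C) (hm : ∀ y, f y ≤ m) (τ : ℝ)
    (x : EuclideanSpace ℝ (Fin d)) :
    heatOp d τ f x ≤ m := by
  have := integral_mono (μ := heatMeasure d) (integrable_comp_sub_smul hf hC τ x)
    (integrable_const m) (fun z => hm _)
  simpa [heatOp] using this

theorem heatOp_comp {f : EuclideanSpace ℝ (Fin d) → V} (hf : Continuous f)
    {C : ℝ} (hC : ∀ y, ‖f y‖ ≤ C) {a b : ℝ} (ha : 0 ≤ a) (hb : 0 ≤ b)
    (x : EuclideanSpace ℝ (Fin d)) :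
    heatOp d a (fun y => heatOp d b f y) x = heatOp d (a + b) f x := by
  have hp : ∀ r : ℝ, IsProbabilityMeasure ((heatMeasure d).map (r • ·)) := fun r =>
    Measure.isProbabilityMeasure_map (by fun_prop)
  have h1 := hp √a
  have h2 := hp √b
  have hmap : ∀ (τ : ℝ) (h : EuclideanSpace ℝ (Fin d) → V), Continuous h →
      ∫ z, h z ∂((heatMeasure d).map (√τ • ·)) = ∫ z, h (√τ • z) ∂(heatMeasure d) :=
    fun τ h hh => integral_map (by fun_prop) hh.aestronglyMeasurable
  have hm : ∀ (τ : ℝ) (y : EuclideanSpace ℝ (Fin d)), heatOp d τ f y =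
      ∫ z, f (y - z) ∂((heatMeasure d).map (√τ • ·)) := by
    intro τ y
    exact (hmap τ (fun z => f (y - z)) (by fun_prop)).symm
  rw [hm (a + b), ← conv_map_smul_heatMeasure d ha hb, integral_conv]
  · rw [integral_map (by fun_prop)]
    · simp only [heatOp]
      refine integral_congr_ae (Eventually.of_forall fun z => ?_)
      simp only
      rw [hmap b (fun y => f (x - (√a • z + y))) (by fun_prop)]
      simp only [sub_sub]
    · refine (StronglyMeasurable.integral_prod_right (f := fun q r => f (x - (q + r))) ?_).aestronglyMeasurable
      exact (hf.comp (by fun_prop : Continuous fun p : EuclideanSpace ℝ (Fin d) ×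
        EuclideanSpace ℝ (Fin d) => x - (p.1 + p.2))).stronglyMeasurable
  · refine Integrable.of_bound (hf.comp (by fun_prop)).aestronglyMeasurable C ?_
    exact Eventually.of_forall fun z => hC _

/-- Averages of a jointly continuous, locally bounded function over the Gaussian measure depend
continuously on parameters. -/
theorem continuous_heatOp {X : Type*} [TopologicalSpace X] [FirstCountableTopology X]
    {f : X → EuclideanSpace ℝ (Fin d) → V} (hf : Continuous (Function.uncurry f))
    (hb : ∀ x₀, ∃ C, ∀ᶠ x in 𝓝 x₀, ∀ y, ‖f x y‖ ≤ C) {τ : X → ℝ} (hτ : Continuous τ)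
    {p : X → EuclideanSpace ℝ (Fin d)} (hp : Continuous p) :
    Continuous fun x => heatOp d (τ x) (f x) (p x) := by
  refine continuous_iff_continuousAt.mpr fun x₀ => ?_
  obtain ⟨C, hC⟩ := hb x₀
  refine tendsto_integral_filter_of_dominated_convergence (fun _ => C) ?_ ?_ (integrable_const _) ?_
  · refine Eventually.of_forall fun x => ?_
    exact (hf.comp (by fun_prop : Continuous fun z => (x, p x - √(τ x) • z))).aestronglyMeasurable
  · filter_upwards [hC] with x hx
    exact Eventually.of_forall fun z => hx _
  · refine Eventually.of_forall fun z => ?_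
    have : Continuous fun x => f x (p x - √(τ x) • z) :=
      hf.comp (by fun_prop : Continuous fun x => (x, p x - √(τ x) • z))
    exact this.tendsto x₀

/-- The exponential factor increases with time, so only the prefactor has to be compensated. This
pointwise bound yields time regularity of the semigroup without differentiating the kernel. -/
theorem rpow_mul_heatKernel_le {s t : ℝ} (hs : 0 < s) (hst : s ≤ t)
    (x : EuclideanSpace ℝ (Fin d)) :
    (s / t) ^ ((d : ℝ) / 2) * heatKernel d s x ≤ heatKernel d t x := by
  have ht : 0 < t := hs.trans_le hst
  have hpi := Real.pi_pos
  unfold heatKernel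
  rw [← mul_assoc]
  have h1 : (s / t) ^ ((d : ℝ) / 2) * (4 * Real.pi * s) ^ (-(d : ℝ) / 2) =
      (4 * Real.pi * t) ^ (-(d : ℝ) / 2) := by
    rw [neg_div, Real.rpow_neg (by positivity), Real.rpow_neg (by positivity),
      Real.div_rpow hs.le ht.le, Real.mul_rpow (by positivity) hs.le,
      Real.mul_rpow (by positivity) ht.le]
    field_simp
  rw [h1]
  refine mul_le_mul_of_nonneg_left (Real.exp_le_exp.mpr ?_) (by positivity)
  rw [neg_div, neg_div, neg_le_neg_iff]
  gcongr

theorem rpow_mul_heatOp_le {f : EuclideanSpace ℝ (Fin d) → ℝ} (hf : Continuous f) {C : ℝ}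
    (hC : ∀ y, ‖f y‖ ≤ C) (hf0 : ∀ y, 0 ≤ f y) {s t : ℝ} (hs : 0 < s) (hst : s ≤ t)
    (x : EuclideanSpace ℝ (Fin d)) :
    (s / t) ^ ((d : ℝ) / 2) * heatOp d s f x ≤ heatOp d t f x := by
  have hi : ∀ r, 0 < r → Integrable fun y => heatKernel d r (x - y) • f y := by
    intro r hr
    -- A non-integrable kernel would have Bochner integral `0`, but the semigroup maps `1` to `1`.
    have hint : Integrable (heatKernel d r) := by
      by_contra h
      have h2 := integral_heatKernel_smul (d := d) hr (fun _ => (1 : ℝ)) 0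
      have h3 : ∫ y, heatKernel d r ((0 : EuclideanSpace ℝ (Fin d)) - y) • (1 : ℝ) =
          ∫ y, heatKernel d r y := by
        simp [heatKernel]
      rw [h3, integral_undef h] at h2
      simp [heatOp] at h2
    exact (hint.comp_sub_left x).mul_bdd (c := C) hf.aestronglyMeasurable (Eventually.of_forall hC)
  rw [← integral_heatKernel_smul hs, ← integral_heatKernel_smul (hs.trans_le hst),
    ← integral_const_mul]
  refine integral_mono ((hi s hs).const_mul _) (hi t (hs.trans_le hst)) fun y => ?_
  simp only [smul_eq_mul, ← mul_assoc]
  exact mul_le_mul_of_nonneg_right (rpow_mul_heatKernel_le hs hst _) (hf0 y)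

/-- The kernel comparison needs nonnegative functions; it is applied to `C - f` and `C + f`, and
constants are invariant under the semigroup. -/
theorem abs_heatOp_sub_heatOp_le {f : EuclideanSpace ℝ (Fin d) → ℝ} (hf : Continuous f) {C : ℝ}
    (hC : ∀ y, ‖f y‖ ≤ C) {s t : ℝ} (hs : 0 < s) (hst : s ≤ t)
    (x : EuclideanSpace ℝ (Fin d)) :
    |heatOp d t f x - heatOp d s f x| ≤ 2 * C * (1 - (s / t) ^ ((d : ℝ) / 2)) := by
  have hC' : ∀ y, |f y| ≤ C := hC
  set c := (s / t) ^ ((d : ℝ) / 2)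
  have hcst : ∀ τ : ℝ, heatOp d τ (fun _ => C) x = C := fun τ => by simp [heatOp]
  have h1 := rpow_mul_heatOp_le (f := fun y => C - f y) (by fun_prop) (C := 2 * C) (fun y => by
    have := abs_le.mp (hC' y)
    rw [Real.norm_eq_abs, abs_le]; constructor <;> linarith) (fun y => by
    have := abs_le.mp (hC' y)
    linarith) hs hst x
  have h2 := rpow_mul_heatOp_le (f := fun y => C - -f y) (by fun_prop) (C := 2 * C) (fun y => by
    have := abs_le.mp (hC' y)
    rw [Real.norm_eq_abs, abs_le]; constructor <;> linarith) (fun y => by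
    have := abs_le.mp (hC' y)
    linarith) hs hst x
  have hn : ∀ τ, heatOp d τ (fun y => -f y) x = -heatOp d τ f x := fun τ => by
    simp [heatOp, integral_neg]
  have hCC : ∀ y : EuclideanSpace ℝ (Fin d), ‖C‖ ≤ |C| := fun _ => le_rfl
  rw [heatOp_sub continuous_const hf hCC hC, heatOp_sub continuous_const hf hCC hC, hcst, hcst] at h1
  rw [heatOp_sub (g := fun y => -f y) continuous_const hf.neg hCC (by simpa using hC),
    heatOp_sub (g := fun y => -f y) continuous_const hf.neg hCC (by simpa using hC), hcst, hcst, hn, hn] at h2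
  have h3 := abs_le.mp (norm_heatOp_le hC s x)
  have hc1 : c ≤ 1 := Real.rpow_le_one (div_nonneg hs.le (hs.le.trans hst)) (div_le_one_of_le₀ hst (by linarith))
    (by positivity)
  rw [abs_le]
  constructor <;> nlinarith [h3.1, h3.2]

end heatOp

/-! ### Damped Duhamel integrals -/

/-- Jointly continuous functions that are bounded on every time interval `(-∞, T]`. -/
structure IsAdmissible {d : ℕ} (Φ : ℝ → EuclideanSpace ℝ (Fin d) → ℝ) : Prop where
  continuous : Continuous (Function.uncurry Φ)
  bounded : ∀ T : ℝ, ∃ C, ∀ s ≤ T, ∀ y, ‖Φ s y‖ ≤ C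

namespace IsAdmissible

variable {d : ℕ} {Φ Ψ : ℝ → EuclideanSpace ℝ (Fin d) → ℝ}

theorem eventually_bounded (h : IsAdmissible Φ) (s₀ : ℝ) : ∃ C, ∀ᶠ s in 𝓝 s₀, ∀ y, ‖Φ s y‖ ≤ C := by
  obtain ⟨C, hC⟩ := h.bounded (s₀ + 1)
  exact ⟨C, (eventually_le_nhds (lt_add_one s₀)).mono hC⟩

theorem slice (h : IsAdmissible Φ) (s : ℝ) : Continuous (Φ s) :=
  h.continuous.comp (by fun_prop : Continuous fun y : EuclideanSpace ℝ (Fin d) => (s, y))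

theorem neg (h : IsAdmissible Φ) : IsAdmissible fun s y => -Φ s y := by
  refine ⟨h.continuous.neg, fun T => ?_⟩
  simpa using h.bounded T

theorem sub (h : IsAdmissible Φ) (h' : IsAdmissible Ψ) : IsAdmissible fun s y => Φ s y - Ψ s y := by
  refine ⟨h.continuous.sub h'.continuous, fun T => ?_⟩
  obtain ⟨C, hC⟩ := h.bounded T
  obtain ⟨C', hC'⟩ := h'.bounded T
  exact ⟨C + C', fun s hs y => (norm_sub_le _ _).trans (add_le_add (hC s hs y) (hC' s hs y))⟩

theorem comp_lipschitz (h : IsAdmissible Φ) {F : ℝ → ℝ} {L : ℝ} (hL : 0 ≤ L)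
    (hF : ∀ x y, |F x - F y| ≤ L * |x - y|) : IsAdmissible fun s y => F (Φ s y) := by
  have hc : Continuous F := by
    refine (LipschitzWith.of_dist_le_mul (K := L.toNNReal) fun x y => ?_).continuous
    simpa [Real.dist_eq, hL] using hF x y
  refine ⟨hc.comp h.continuous, fun T => ?_⟩
  obtain ⟨C, hC⟩ := h.bounded T
  refine ⟨|F 0| + L * C, fun s hs y => ?_⟩
  have h1 := hF (Φ s y) 0
  have h2 : |F (Φ s y)| ≤ |F 0| + |F (Φ s y) - F 0| := by
    have := abs_add_le (F 0) (F (Φ s y) - F 0)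
    simpa using this
  have h3 : |Φ s y| ≤ C := hC s hs y
  rw [sub_zero] at h1
  rw [Real.norm_eq_abs]
  nlinarith

theorem continuous_heatOp_comp {X : Type*} [TopologicalSpace X] [FirstCountableTopology X]
    (h : IsAdmissible Φ) {s τ : X → ℝ} {p : X → EuclideanSpace ℝ (Fin d)} (hs : Continuous s)
    (hτ : Continuous τ) (hp : Continuous p) :
    Continuous fun x => heatOp d (τ x) (Φ (s x)) (p x) := by
  refine continuous_heatOp (f := fun x => Φ (s x)) ?_ (fun x₀ => ?_) hτ hp
  · exact h.continuous.comp (by fun_prop : Continuous fun q : X × EuclideanSpace ℝ (Fin d) =>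
      (s q.1, q.2))
  · obtain ⟨C, hC⟩ := h.eventually_bounded (s x₀)
    exact ⟨C, (hs.tendsto x₀).eventually hC⟩

end IsAdmissible

/-- The damped Duhamel integral `∫₀ᵗ e^{-L(t-s)} e^{(t-s)Δ} Φ(s) ds`. -/
noncomputable def duhamelShift {d : ℕ} (L : ℝ) (Φ : ℝ → EuclideanSpace ℝ (Fin d) → ℝ) (t : ℝ)
    (x : EuclideanSpace ℝ (Fin d)) : ℝ :=
  ∫ s in (0 : ℝ)..t, Real.exp (-L * (t - s)) * heatOp d (t - s) (Φ s) x

section duhamelShift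

variable {d : ℕ} {Φ Ψ : ℝ → EuclideanSpace ℝ (Fin d) → ℝ} {L : ℝ}

theorem IsAdmissible.continuous_integrand (h : IsAdmissible Φ) (L t : ℝ)
    (x : EuclideanSpace ℝ (Fin d)) :
    Continuous fun s => Real.exp (-L * (t - s)) * heatOp d (t - s) (Φ s) x :=
  (by fun_prop : Continuous fun s => Real.exp (-L * (t - s))).mul
    (h.continuous_heatOp_comp continuous_id (by fun_prop) continuous_const)

theorem IsAdmissible.continuous_duhamelShift (h : IsAdmissible Φ) (L : ℝ) :
    Continuous fun p : ℝ × EuclideanSpace ℝ (Fin d) => duhamelShift L Φ p.1 p.2 := by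
  unfold duhamelShift
  refine intervalIntegral.continuous_parametric_intervalIntegral_of_continuous ?_ continuous_fst
  simp only [Function.uncurry_def]
  exact (by fun_prop : Continuous fun q : (ℝ × EuclideanSpace ℝ (Fin d)) × ℝ =>
    Real.exp (-L * (q.1.1 - q.2))).mul
    (h.continuous_heatOp_comp continuous_snd (by fun_prop) (by fun_prop))

theorem duhamelShift_neg (t : ℝ) (x : EuclideanSpace ℝ (Fin d)) :
    duhamelShift L (fun s y => -Φ s y) t x = -duhamelShift L Φ t x := by
  simp [duhamelShift, heatOp, integral_neg]

theorem duhamelShift_sub (h : IsAdmissible Φ) (h' : IsAdmissible Ψ) (t : ℝ)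
    (x : EuclideanSpace ℝ (Fin d)) :
    duhamelShift L (fun s y => Φ s y - Ψ s y) t x =
      duhamelShift L Φ t x - duhamelShift L Ψ t x := by
  unfold duhamelShift
  rw [← intervalIntegral.integral_sub ((h.continuous_integrand L t x).intervalIntegrable _ _)
    ((h'.continuous_integrand L t x).intervalIntegrable _ _)]
  refine intervalIntegral.integral_congr fun s _ => ?_
  obtain ⟨C, hC⟩ := h.bounded s
  obtain ⟨C', hC'⟩ := h'.bounded s
  simp only
  rw [heatOp_sub (h.slice s) (h'.slice s) (hC s le_rfl) (hC' s le_rfl), mul_sub]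

/-- Averaging against a probability measure preserves spatially constant upper bounds, which reduces
estimates for the PDE to scalar integrals. -/
theorem duhamelShift_le_integral (h : IsAdmissible Φ) {ψ : ℝ → ℝ} (hψ : Continuous ψ) {t : ℝ}
    (ht : 0 ≤ t) (hle : ∀ s ∈ Icc 0 t, ∀ y, Φ s y ≤ ψ s) (x : EuclideanSpace ℝ (Fin d)) :
    duhamelShift L Φ t x ≤ ∫ s in (0 : ℝ)..t, Real.exp (-L * (t - s)) * ψ s := by
  refine intervalIntegral.integral_mono_on ht ((h.continuous_integrand L t x).intervalIntegrable _ _)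
    ((by fun_prop : Continuous fun s => Real.exp (-L * (t - s)) * ψ s).intervalIntegrable _ _)
    fun s hs => ?_
  obtain ⟨C, hC⟩ := h.bounded s
  exact mul_le_mul_of_nonneg_left (heatOp_le (h.slice s) (hC s le_rfl) (hle s hs) _ x)
    (Real.exp_pos _).le

theorem integral_exp_mul_le {lam : ℝ} (hlam : 0 < lam) {m : ℝ} (hm : 0 ≤ m) (t : ℝ) :
    ∫ s in (0 : ℝ)..t, m * Real.exp (lam * s) ≤ m / lam * Real.exp (lam * t) := by
  have h : ∀ s ∈ uIcc 0 t, HasDerivAt (fun s => m / lam * Real.exp (lam * s))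
      (m * Real.exp (lam * s)) s := by
    intro s _
    have := (((hasDerivAt_id s).const_mul lam).exp).const_mul (m / lam)
    convert! this using 1
    simp only [id]; field_simp
  rw [intervalIntegral.integral_eq_sub_of_hasDerivAt h
    ((by fun_prop : Continuous fun s => m * Real.exp (lam * s)).intervalIntegrable _ _)]
  have : 0 ≤ m / lam * Real.exp (lam * 0) := by positivity
  linarith

/-- The gain `1 / lam` in the weight `e^{lam t}` drives both the contraction and the comparison
argument, on time intervals of any length. -/
theorem integral_shift_exp_mul_le (hL : 0 ≤ L) {lam : ℝ} (hlam : 0 < lam) {m : ℝ} (hm : 0 ≤ m)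
    {t : ℝ} (ht : 0 ≤ t) :
    ∫ s in (0 : ℝ)..t, Real.exp (-L * (t - s)) * (m * Real.exp (lam * s)) ≤
      m / lam * Real.exp (lam * t) := by
  refine le_trans (intervalIntegral.integral_mono_on ht
    ((by fun_prop : Continuous fun s => Real.exp (-L * (t - s)) *
      (m * Real.exp (lam * s))).intervalIntegrable _ _)
    ((by fun_prop : Continuous fun s => m * Real.exp (lam * s)).intervalIntegrable _ _)
    fun s hs => ?_) (integral_exp_mul_le hlam hm t)
  have : Real.exp (-L * (t - s)) ≤ 1 := Real.exp_le_one_iff.mpr (by nlinarith [hs.2])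
  exact mul_le_of_le_one_left (by positivity) this

theorem abs_duhamelShift_le (h : IsAdmissible Φ) (hL : 0 ≤ L) {lam : ℝ} (hlam : 0 < lam) {m : ℝ}
    (hm : 0 ≤ m) {t : ℝ} (ht : 0 ≤ t)
    (hle : ∀ s ∈ Icc 0 t, ∀ y, |Φ s y| ≤ m * Real.exp (lam * s)) (x : EuclideanSpace ℝ (Fin d)) :
    |duhamelShift L Φ t x| ≤ m / lam * Real.exp (lam * t) := by
  have hI := integral_shift_exp_mul_le hL hlam hm ht
  have hc : Continuous fun s => m * Real.exp (lam * s) := by fun_prop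
  rw [abs_le']
  constructor
  · exact (duhamelShift_le_integral h hc ht (fun s hs y => (le_abs_self _).trans (hle s hs y)) x).trans hI
  · rw [← duhamelShift_neg]
    exact (duhamelShift_le_integral h.neg hc ht
      (fun s hs y => (neg_le_abs _).trans (hle s hs y)) x).trans hI

end duhamelShift

/-! ### Lipschitz nonlinearities: global existence and comparison -/

/-- Mild solutions of `∂ₜ u = Δu + F(u)`, `u(0) = g`, with the linear damping `-Lu` absorbed into
the semigroup. -/
structure IsShiftedMild {d : ℕ} (F : ℝ → ℝ) (L : ℝ) (g : EuclideanSpace ℝ (Fin d) →ᵇ ℝ)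
    (u : ℝ → EuclideanSpace ℝ (Fin d) → ℝ) : Prop where
  admissible : IsAdmissible u
  eq : ∀ t, 0 ≤ t → ∀ x, u t x = Real.exp (-L * t) * heatOp d t g x +
    duhamelShift L (fun s y => F (u s y) + L * u s y) t x

theorem abs_add_mul_sub_le {F : ℝ → ℝ} {L : ℝ} (hF : ∀ x y, |F x - F y| ≤ L * |x - y|) (hL : 0 ≤ L)
    (x y : ℝ) : |(F x + L * x) - (F y + L * y)| ≤ (2 * L) * |x - y| := by
  have h : (F x + L * x) - (F y + L * y) = (F x - F y) + L * (x - y) := by ring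
  rw [h]
  refine (abs_add_le _ _).trans ?_
  rw [abs_mul, abs_of_nonneg hL]
  linarith [hF x y]

/-- This monotonicity is the purpose of the damping: it makes the Duhamel operator order preserving.
-/
theorem add_mul_le_add_mul {F : ℝ → ℝ} {L : ℝ} (hF : ∀ x y, |F x - F y| ≤ L * |x - y|) {x y : ℝ}
    (hxy : x ≤ y) : F x + L * x ≤ F y + L * y := by
  have h := (abs_le.mp (hF x y)).2
  rw [abs_of_nonpos (by linarith)] at h
  linarith

/-- Banach's fixed point theorem for `w = e^{-lam t} u` in the bounded continuous functions on all
of space-time; the weight makes one application cover all times. -/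
theorem exists_isShiftedMild {d : ℕ} {F : ℝ → ℝ} {L : ℝ} (hL : 0 < L)
    (hF : ∀ x y, |F x - F y| ≤ L * |x - y|) (g : EuclideanSpace ℝ (Fin d) →ᵇ ℝ) :
    ∃ u, IsShiftedMild F L g u := by
  set H : ℝ → ℝ := fun x => F x + L * x with hH
  have hHL : ∀ x y, |H x - H y| ≤ (2 * L) * |x - y| := abs_add_mul_sub_le hF hL.le
  -- `H` has Lipschitz constant `2L`, so the contraction factor is `2L / lam = 1/2`.
  set lam : ℝ := 4 * L with hlam
  have hlam0 : 0 < lam := by positivity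
  -- Clamping time at `0` lets the functions live on all of `ℝ`; the weight is `1` at negative
  -- times, as boundedness on `(-∞, T]` requires.
  let U : ((ℝ × EuclideanSpace ℝ (Fin d)) →ᵇ ℝ) → ℝ → EuclideanSpace ℝ (Fin d) → ℝ :=
    fun w t x => Real.exp (lam * max t 0) * w (t, x)
  have hU : ∀ w, IsAdmissible (U w) := by
    intro w
    refine ⟨?_, fun T => ⟨Real.exp (lam * max T 0) * ‖w‖, fun s hs y => ?_⟩⟩
    · simp only [U, Function.uncurry_def]; fun_prop
    · simp only [U]
      rw [norm_mul, Real.norm_of_nonneg (Real.exp_pos _).le]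
      gcongr
      exact w.norm_coe_le_norm _
  have hHU : ∀ w, IsAdmissible fun s y => H (U w s y) := fun w =>
    (hU w).comp_lipschitz (by positivity) hHL
  let P : ((ℝ × EuclideanSpace ℝ (Fin d)) →ᵇ ℝ) → ℝ × EuclideanSpace ℝ (Fin d) → ℝ := fun w p =>
    Real.exp (-lam * max p.1 0) * (Real.exp (-L * max p.1 0) * heatOp d (max p.1 0) g p.2 +
      duhamelShift L (fun s y => H (U w s y)) (max p.1 0) p.2)
  have hPc : ∀ w, Continuous (P w) := by
    intro w
    have h1 : Continuous fun p : ℝ × EuclideanSpace ℝ (Fin d) =>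
        heatOp d (max p.1 0) g p.2 :=
      continuous_heatOp (f := fun _ => g) (by simp only [Function.uncurry_def]; fun_prop)
        (fun _ => ⟨‖g‖, Eventually.of_forall fun _ y => g.norm_coe_le_norm y⟩)
        (by fun_prop) (by fun_prop)
    have h2 : Continuous fun p : ℝ × EuclideanSpace ℝ (Fin d) =>
        duhamelShift L (fun s y => H (U w s y)) (max p.1 0) p.2 :=
      ((hHU w).continuous_duhamelShift L).comp (by fun_prop :
        Continuous fun p : ℝ × EuclideanSpace ℝ (Fin d) => (max p.1 0, p.2))
    simp only [P]
    fun_prop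
  have hexp : ∀ a : ℝ, Real.exp (-lam * a) * Real.exp (lam * a) = 1 := fun a => by
    rw [← Real.exp_add]; simp
  have hmaxs : ∀ (t s : ℝ), s ∈ Icc 0 (max t 0) → max s 0 = s := fun t s hs => max_eq_left hs.1
  have hPb : ∀ w p, ‖P w p‖ ≤ ‖g‖ + (|H 0| + 2 * L * ‖w‖) / lam := by
    intro w p
    have ht : 0 ≤ max p.1 0 := le_max_right _ _
    have h1 : |heatOp d (max p.1 0) g p.2| ≤ ‖g‖ := norm_heatOp_le g.norm_coe_le_norm _ _
    have h2 := abs_duhamelShift_le (hHU w) hL.le hlam0 (m := |H 0| + 2 * L * ‖w‖) (by positivity) ht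
      (fun s hs y => by
        have h3 := hHL (U w s y) 0
        have h4 : |H (U w s y)| ≤ |H 0| + |H (U w s y) - H 0| := by
          simpa using abs_add_le (H 0) (H (U w s y) - H 0)
        have h5 : |U w s y| ≤ Real.exp (lam * s) * ‖w‖ := by
          simp only [U, hmaxs p.1 s hs]
          rw [abs_mul, abs_of_pos (Real.exp_pos _)]
          gcongr
          exact w.norm_coe_le_norm _
        have h6 : 1 ≤ Real.exp (lam * s) := Real.one_le_exp (by nlinarith [hs.1])
        rw [sub_zero] at h3
        nlinarith [abs_nonneg (H 0), mul_le_mul_of_nonneg_left h5 (by positivity : 0 ≤ 2 * L)]) p.2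
    simp only [P]
    rw [norm_mul, Real.norm_of_nonneg (Real.exp_pos _).le, Real.norm_eq_abs]
    have h3 : Real.exp (-L * max p.1 0) ≤ 1 := Real.exp_le_one_iff.mpr (by nlinarith)
    have h4 : |Real.exp (-L * max p.1 0) * heatOp d (max p.1 0) g p.2| ≤ ‖g‖ := by
      rw [abs_mul, abs_of_pos (Real.exp_pos _)]
      exact (mul_le_of_le_one_left (abs_nonneg _) h3).trans h1
    have h5 := (abs_add_le _ _).trans (add_le_add h4 h2)
    refine (mul_le_mul_of_nonneg_left h5 (Real.exp_pos (-lam * max p.1 0)).le).trans ?_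
    have h6 := hexp (max p.1 0)
    have h7 : Real.exp (-lam * max p.1 0) ≤ 1 := Real.exp_le_one_iff.mpr (by nlinarith)
    have : Real.exp (-lam * max p.1 0) * (‖g‖ + (|H 0| + 2 * L * ‖w‖) / lam *
        Real.exp (lam * max p.1 0)) = Real.exp (-lam * max p.1 0) * ‖g‖ +
        (|H 0| + 2 * L * ‖w‖) / lam *
        (Real.exp (-lam * max p.1 0) * Real.exp (lam * max p.1 0)) := by ring
    rw [this, h6, mul_one]
    exact add_le_add_left (mul_le_of_le_one_left (norm_nonneg _) h7) _
  let Q : ((ℝ × EuclideanSpace ℝ (Fin d)) →ᵇ ℝ) → ((ℝ × EuclideanSpace ℝ (Fin d)) →ᵇ ℝ) := fun w =>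
    BoundedContinuousFunction.ofNormedAddCommGroup (P w) (hPc w) _ (hPb w)
  have hcontr : ContractingWith (1 / 2) Q := by
    refine ⟨by rw [← NNReal.coe_lt_coe]; norm_num, LipschitzWith.of_dist_le_mul fun w w' => ?_⟩
    rw [BoundedContinuousFunction.dist_le (by positivity)]
    intro p
    have ht : 0 ≤ max p.1 0 := le_max_right _ _
    have h2 := abs_duhamelShift_le ((hHU w).sub (hHU w')) hL.le hlam0 (m := 2 * L * dist w w')
      (by positivity) ht (fun s hs y => by
        refine (hHL _ _).trans ?_
        rw [mul_assoc (2 * L)]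
        have h5 : |U w s y - U w' s y| ≤ dist w w' * Real.exp (lam * s) := by
          simp only [U, hmaxs p.1 s hs]
          rw [← mul_sub, abs_mul, abs_of_pos (Real.exp_pos _), mul_comm]
          gcongr
          rw [← Real.dist_eq]
          exact BoundedContinuousFunction.dist_coe_le_dist _
        gcongr) p.2
    rw [duhamelShift_sub (hHU w) (hHU w')] at h2
    have h3 : Q w p - Q w' p = Real.exp (-lam * max p.1 0) *
        (duhamelShift L (fun s y => H (U w s y)) (max p.1 0) p.2 -
          duhamelShift L (fun s y => H (U w' s y)) (max p.1 0) p.2) := by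
      simp only [Q, P, BoundedContinuousFunction.coe_ofNormedAddCommGroup]
      ring
    rw [Real.dist_eq, h3, abs_mul, abs_of_pos (Real.exp_pos _)]
    refine (mul_le_mul_of_nonneg_left h2 (Real.exp_pos _).le).trans (le_of_eq ?_)
    have h6 := hexp (max p.1 0)
    have : Real.exp (-lam * max p.1 0) * (2 * L * dist w w' / lam * Real.exp (lam * max p.1 0)) =
      2 * L * dist w w' / lam * (Real.exp (-lam * max p.1 0) * Real.exp (lam * max p.1 0)) := by ring
    rw [this, h6, hlam]
    push_cast
    field_simp
    ring
  set w := ContractingWith.fixedPoint Q hcontr with hw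
  have hfix : Q w = w := hcontr.fixedPoint_isFixedPt
  refine ⟨U w, hU w, fun t ht x => ?_⟩
  have h1 : w (t, x) = P w (t, x) := by
    conv_lhs => rw [← hfix]
    rfl
  have h2 : U w t x = Real.exp (lam * t) * w (t, x) := by simp only [U, max_eq_left ht]
  have h3 := hexp t
  rw [h2, h1]
  simp only [P, max_eq_left ht]
  rw [← mul_assoc, mul_comm (Real.exp (lam * t)), h3, one_mul]

namespace IsShiftedMild

variable {d : ℕ} {F : ℝ → ℝ} {L : ℝ} {g : EuclideanSpace ℝ (Fin d) →ᵇ ℝ}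
  {u : ℝ → EuclideanSpace ℝ (Fin d) → ℝ}

theorem neg (h : IsShiftedMild F L g u) :
    IsShiftedMild (fun x => -F (-x)) L (-g) fun t x => -u t x := by
  refine ⟨h.admissible.neg, fun t ht x => ?_⟩
  rw [h.eq t ht x]
  have h1 : heatOp d t (⇑(-g)) x = -heatOp d t g x := by
    simp [heatOp, integral_neg]
  have h2 : (fun s y => -F (- -u s y) + L * -u s y) = fun s y => -(F (u s y) + L * u s y) := by
    ext s y; rw [neg_neg]; ring
  rw [h1, h2, duhamelShift_neg]
  ring

/-- Comparison with spatially constant supersolutions. -/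
theorem le_of_supersolution (h : IsShiftedMild F L g u) (hL : 0 < L)
    (hF : ∀ x y, |F x - F y| ≤ L * |x - y|) {φ φ' : ℝ → ℝ} (hφ : ∀ t, HasDerivAt φ (φ' t) t)
    (hφ' : Continuous φ') (h0 : ∀ x, g x ≤ φ 0) (hsup : ∀ t, 0 ≤ t → F (φ t) ≤ φ' t) {t : ℝ}
    (ht : 0 ≤ t) (x : EuclideanSpace ℝ (Fin d)) : u t x ≤ φ t := by
  set lam : ℝ := 4 * L with hlam
  have hlam0 : 0 < lam := by positivity
  have hφc : Continuous φ := continuous_iff_continuousAt.mpr fun s => (hφ s).continuousAt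
  have hAdm : IsAdmissible fun s y => F (u s y) + L * u s y :=
    h.admissible.comp_lipschitz (F := fun z => F z + L * z) (by positivity)
      (abs_add_mul_sub_le hF hL.le)
  -- Variation of constants puts `φ` in the same damped form as `u`, so that the two can be compared
  -- term by term.
  have hrep : ∀ s, φ s = Real.exp (-L * s) * φ 0 +
      ∫ r in (0 : ℝ)..s, Real.exp (-L * (s - r)) * (φ' r + L * φ r) := by
    intro s
    have hd : ∀ r ∈ uIcc 0 s, HasDerivAt (fun r => Real.exp (-L * (s - r)) * φ r)
        (Real.exp (-L * (s - r)) * (φ' r + L * φ r)) r := by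
      intro r _
      have h1 : HasDerivAt (fun r => -L * (s - r)) L r := by
        have := ((hasDerivAt_id r).const_sub s).const_mul (-L)
        simpa using this
      have h2 := h1.exp.mul (hφ r)
      convert! h2 using 1
      ring
    rw [intervalIntegral.integral_eq_sub_of_hasDerivAt hd
      ((by fun_prop : Continuous fun r => Real.exp (-L * (s - r)) *
        (φ' r + L * φ r)).intervalIntegrable _ _)]
    simp
  -- Monotonicity replaces `u` by `φ + m e^{lam r}` in `F + L`; the Lipschitz bound costs `2L m
  -- e^{lam r}`, and integration against the weight divides by `lam = 4L`.
  have hstep : ∀ m, 0 ≤ m → (∀ s ∈ Icc 0 t, ∀ y, u s y - φ s ≤ m * Real.exp (lam * s)) →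
      ∀ s ∈ Icc 0 t, ∀ y, u s y - φ s ≤ m / 2 * Real.exp (lam * s) := by
    intro m hm hle s hs y
    have hc : Continuous fun r => (φ' r + L * φ r) + (2 * L * m) * Real.exp (lam * r) := by
      fun_prop
    have h1 := duhamelShift_le_integral (L := L) hAdm hc hs.1 (fun r hr z => by
      have hrt : r ∈ Icc 0 t := ⟨hr.1, hr.2.trans hs.2⟩
      have h2 := add_mul_le_add_mul hF (by linarith [hle r hrt z] :
        u r z ≤ φ r + m * Real.exp (lam * r))
      have h3 := (abs_le.mp (abs_add_mul_sub_le hF hL.le (φ r + m * Real.exp (lam * r)) (φ r))).2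
      rw [add_sub_cancel_left, abs_of_nonneg (by positivity)] at h3
      linarith [hsup r hr.1]) y
    have h4 : ∫ r in (0 : ℝ)..s, Real.exp (-L * (s - r)) *
        ((φ' r + L * φ r) + (2 * L * m) * Real.exp (lam * r)) =
        (∫ r in (0 : ℝ)..s, Real.exp (-L * (s - r)) * (φ' r + L * φ r)) +
        ∫ r in (0 : ℝ)..s, Real.exp (-L * (s - r)) * ((2 * L * m) * Real.exp (lam * r)) := by
      rw [← intervalIntegral.integral_add]
      · simp_rw [mul_add]
      · exact (by fun_prop : Continuous fun r => Real.exp (-L * (s - r)) *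
          (φ' r + L * φ r)).intervalIntegrable _ _
      · exact (by fun_prop : Continuous fun r => Real.exp (-L * (s - r)) *
          ((2 * L * m) * Real.exp (lam * r))).intervalIntegrable _ _
    have h5 := integral_shift_exp_mul_le hL.le hlam0 (by positivity : 0 ≤ 2 * L * m) hs.1
    have h6 : heatOp d s g y ≤ φ 0 := heatOp_le g.continuous g.norm_coe_le_norm h0 s y
    have h7 := mul_le_mul_of_nonneg_left h6 (Real.exp_pos (-L * s)).le
    have h8 : 2 * L * m / lam = m / 2 := by rw [hlam]; field_simp; ring
    rw [h8] at h5
    rw [h4] at h1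
    rw [h.eq s hs.1 y, hrep s]
    linarith
  obtain ⟨C, hC⟩ := h.admissible.bounded t
  obtain ⟨C', hC'⟩ := (isCompact_Icc (a := (0 : ℝ)) (b := t)).exists_bound_of_continuousOn hφc.continuousOn
  have hCC : 0 ≤ |C + C'| := abs_nonneg _
  have hiter : ∀ n : ℕ, ∀ s ∈ Icc 0 t, ∀ y, u s y - φ s ≤ |C + C'| * (1 / 2) ^ n * Real.exp (lam * s) := by
    intro n
    induction n with
    | zero =>
      intro s hs y
      have h1 := (le_abs_self _).trans (hC s hs.2 y)
      have h2 := (neg_le_abs _).trans (hC' s hs)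
      have h3 : 1 ≤ Real.exp (lam * s) := Real.one_le_exp (by nlinarith [hs.1])
      have h4 := le_abs_self (C + C')
      rw [pow_zero, mul_one]
      nlinarith
    | succ n ih =>
      have := hstep _ (by positivity) ih
      intro s hs y
      refine (this s hs y).trans (le_of_eq ?_)
      rw [pow_succ]; ring
  have hlim : Tendsto (fun n : ℕ => |C + C'| * (1 / 2 : ℝ) ^ n * Real.exp (lam * t)) atTop (𝓝 0) := by
    have := ((tendsto_pow_atTop_nhds_zero_of_lt_one (by norm_num : (0 : ℝ) ≤ 1 / 2)
      (by norm_num)).const_mul |C + C'|).mul_const (Real.exp (lam * t))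
    simpa using this
  have := ge_of_tendsto' hlim fun n => hiter n t ⟨ht, le_rfl⟩ x
  linarith

/-- Comparison with spatially constant subsolutions. -/
theorem ge_of_subsolution (h : IsShiftedMild F L g u) (hL : 0 < L)
    (hF : ∀ x y, |F x - F y| ≤ L * |x - y|) {φ φ' : ℝ → ℝ} (hφ : ∀ t, HasDerivAt φ (φ' t) t)
    (hφ' : Continuous φ') (h0 : ∀ x, φ 0 ≤ g x) (hsub : ∀ t, 0 ≤ t → φ' t ≤ F (φ t)) {t : ℝ}
    (ht : 0 ≤ t) (x : EuclideanSpace ℝ (Fin d)) : φ t ≤ u t x := by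
  -- The function `-u` solves the equation with nonlinearity `x ↦ -F(-x)`, for which `-φ` is a
  -- supersolution.
  have := h.neg.le_of_supersolution hL (fun x y => by
      have := hF (-x) (-y)
      rwa [← abs_neg, show -x - -y = -(x - y) by ring, abs_neg (x - y),
        show -(F (-x) - F (-y)) = -F (-x) - -F (-y) by ring] at this)
    (φ := fun t => -φ t) (φ' := fun t => -φ' t) (fun t => (hφ t).neg) hφ'.neg
    (fun x => by simpa using h0 x) (fun t ht => by simpa using hsub t ht) ht x
  linarith

end IsShiftedMild

/-! ### Removal of the damping and regularity in time -/

section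

variable {d : ℕ} {Φ : ℝ → EuclideanSpace ℝ (Fin d) → ℝ}

theorem heatOp_add {V : Type*} [NormedAddCommGroup V] [NormedSpace ℝ V]
    {f g : EuclideanSpace ℝ (Fin d) → V} (hf : Continuous f) (hg : Continuous g)
    {C C' : ℝ} (hC : ∀ y, ‖f y‖ ≤ C) (hC' : ∀ y, ‖g y‖ ≤ C') (τ : ℝ)
    (x : EuclideanSpace ℝ (Fin d)) :
    heatOp d τ (fun y => f y + g y) x = heatOp d τ f x + heatOp d τ g x :=
  integral_add (integrable_comp_sub_smul hf hC τ x) (integrable_comp_sub_smul hg hC' τ x)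

theorem heatOp_const_mul (c τ : ℝ) (f : EuclideanSpace ℝ (Fin d) → ℝ)
    (x : EuclideanSpace ℝ (Fin d)) : heatOp d τ (fun y => c * f y) x = c * heatOp d τ f x :=
  integral_const_mul _ _

/-- The heat semigroup commutes with the time integral in Duhamel's formula. -/
theorem heatOp_duhamelShift (h : IsAdmissible Φ) (L : ℝ) {s t : ℝ} (hs : 0 ≤ s) (hst : s ≤ t)
    (x : EuclideanSpace ℝ (Fin d)) :
    heatOp d (t - s) (duhamelShift L Φ s) x =
      ∫ r in (0 : ℝ)..s, Real.exp (-L * (s - r)) * heatOp d (t - r) (Φ r) x := by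
  unfold duhamelShift
  rw [heatOp]
  simp_rw [intervalIntegral.integral_of_le hs]
  rw [integral_integral_swap]
  · refine setIntegral_congr_fun measurableSet_Ioc fun r hr => ?_
    obtain ⟨C, hC⟩ := h.bounded r
    rw [integral_const_mul, ← show (t - s) + (s - r) = t - r by ring,
      ← heatOp_comp (h.slice r) (hC r le_rfl) (by linarith) (by linarith [hr.2])]
    rfl
  · obtain ⟨C, hC⟩ := h.bounded s
    refine Integrable.of_bound (C := Real.exp (|L| * s) * C) ?_ ?_
    · have hc : Continuous fun p : EuclideanSpace ℝ (Fin d) × ℝ =>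
          Real.exp (-L * (s - p.2)) * heatOp d (s - p.2) (Φ p.2) (x - √(t - s) • p.1) :=
        (by fun_prop : Continuous fun p : EuclideanSpace ℝ (Fin d) × ℝ =>
          Real.exp (-L * (s - p.2))).mul
          (h.continuous_heatOp_comp continuous_snd (by fun_prop) (by fun_prop))
      exact hc.aestronglyMeasurable
    · have : (heatMeasure d).prod (volume.restrict (Ioc 0 s)) =
          ((heatMeasure d).prod volume).restrict (univ ×ˢ Ioc 0 s) := by
        rw [← Measure.prod_restrict, Measure.restrict_univ]
      rw [this]
      refine ae_restrict_of_forall_mem (MeasurableSet.univ.prod measurableSet_Ioc) fun p hp => ?_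
      have hp2 : p.2 ∈ Ioc 0 s := hp.2
      simp only [Function.uncurry_def]
      rw [norm_mul, Real.norm_of_nonneg (Real.exp_pos _).le]
      refine mul_le_mul (Real.exp_le_exp.mpr ?_) (norm_heatOp_le (hC p.2 hp2.2) _ _)
        (norm_nonneg _) (Real.exp_pos _).le
      have h1 := neg_le_abs L
      have h2 := abs_nonneg L
      nlinarith [hp2.1, hp2.2, mul_le_mul_of_nonneg_right h1 (by linarith [hp2.2] : 0 ≤ s - p.2)]

/-- For fixed `t` and `x`, applying `e^{(t-s)Δ}` to the damped formula at time `s` gives `e^{-Ls} A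
+ J s`, where `J' = q - L J`. The undamped integrand is exactly the derivative of this expression in
`s`, so the fundamental theorem of calculus finishes. -/
theorem IsShiftedMild.duhamel {F : ℝ → ℝ} {L : ℝ} {g : EuclideanSpace ℝ (Fin d) →ᵇ ℝ}
    {u : ℝ → EuclideanSpace ℝ (Fin d) → ℝ} (h : IsShiftedMild F L g u) (hL : 0 ≤ L)
    (hF : ∀ x y, |F x - F y| ≤ L * |x - y|) {t : ℝ} (ht : 0 ≤ t) (x : EuclideanSpace ℝ (Fin d)) :
    u t x = heatOp d t g x + ∫ s in (0 : ℝ)..t, heatOp d (t - s) (fun y => F (u s y)) x := by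
  set G : ℝ → EuclideanSpace ℝ (Fin d) → ℝ := fun s y => F (u s y) + L * u s y with hG
  have hAdm : IsAdmissible G :=
    h.admissible.comp_lipschitz (F := fun z => F z + L * z) (by positivity)
      (abs_add_mul_sub_le hF hL)
  have hAdmF : IsAdmissible fun s y => F (u s y) := h.admissible.comp_lipschitz hL hF
  set q : ℝ → ℝ := fun r => heatOp d (t - r) (G r) x with hq
  have hqc : Continuous q := hAdm.continuous_heatOp_comp continuous_id (by fun_prop) continuous_const
  set J : ℝ → ℝ := fun s => ∫ r in (0 : ℝ)..s, Real.exp (-L * (s - r)) * q r with hJ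
  set A := heatOp d t g x with hA
  have hu : ∀ s ∈ Icc 0 t, heatOp d (t - s) (u s) x = Real.exp (-L * s) * A + J s := by
    intro s hs
    have h1 : u s = fun y => Real.exp (-L * s) * heatOp d s g y + duhamelShift L G s y := by
      ext y; exact h.eq s hs.1 y
    obtain ⟨C, hC⟩ := h.admissible.bounded s
    have hgc : Continuous fun y => heatOp d s g y :=
      continuous_heatOp (f := fun _ => g) (by simp only [Function.uncurry_def]; fun_prop)
        (fun _ => ⟨‖g‖, Eventually.of_forall fun _ y => g.norm_coe_le_norm y⟩)
        continuous_const continuous_id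
    have hgb : ∀ y, ‖Real.exp (-L * s) * heatOp d s g y‖ ≤ Real.exp (-L * s) * ‖g‖ := by
      intro y
      rw [norm_mul, Real.norm_of_nonneg (Real.exp_pos _).le]
      exact mul_le_mul_of_nonneg_left (norm_heatOp_le g.norm_coe_le_norm _ _) (Real.exp_pos _).le
    have hdc : Continuous fun y => duhamelShift L G s y :=
      (hAdm.continuous_duhamelShift L).comp
        (by fun_prop : Continuous fun y : EuclideanSpace ℝ (Fin d) => (s, y))
    -- The Duhamel term is bounded as the difference of `u` and the free part.
    have hdb : ∀ y, ‖duhamelShift L G s y‖ ≤ C + Real.exp (-L * s) * ‖g‖ := by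
      intro y
      have : duhamelShift L G s y = u s y - Real.exp (-L * s) * heatOp d s g y := by
        rw [h.eq s hs.1 y]; ring
      rw [this]
      exact (norm_sub_le _ _).trans (add_le_add (hC s le_rfl y) (hgb y))
    rw [h1, heatOp_add (hgc.const_mul _) hdc hgb hdb, heatOp_const_mul,
      heatOp_comp g.continuous g.norm_coe_le_norm (by linarith [hs.2]) hs.1,
      heatOp_duhamelShift hAdm L hs.1 hs.2, sub_add_cancel]
  have hFq : ∀ s ∈ Icc 0 t, heatOp d (t - s) (fun y => F (u s y)) x =
      q s - L * (Real.exp (-L * s) * A + J s) := by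
    intro s hs
    obtain ⟨C, hC⟩ := h.admissible.bounded s
    obtain ⟨C', hC'⟩ := hAdmF.bounded s
    have h1 : q s = heatOp d (t - s) (fun y => F (u s y)) x +
        heatOp d (t - s) (fun y => L * u s y) x :=
      heatOp_add (hAdmF.slice s) ((h.admissible.slice s).const_mul L) (hC' s le_rfl)
        (C' := |L| * C) (fun y => by
          rw [norm_mul]
          exact mul_le_mul_of_nonneg_left (hC s le_rfl y) (abs_nonneg _)) _ _
    rw [h1, heatOp_const_mul, hu s hs]
    ring
  have hJd : ∀ s, HasDerivAt J (q s - L * J s) s := by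
    intro s
    have hJe : ∀ s, J s = Real.exp (-L * s) * ∫ r in (0 : ℝ)..s, Real.exp (L * r) * q r := by
      intro s
      rw [← intervalIntegral.integral_const_mul]
      refine intervalIntegral.integral_congr fun r _ => ?_
      rw [← mul_assoc, ← Real.exp_add]
      ring_nf
    have hc : Continuous fun r => Real.exp (L * r) * q r := by fun_prop
    have h1 := intervalIntegral.integral_hasDerivAt_right (hc.intervalIntegrable 0 s)
      (hc.stronglyMeasurableAtFilter _ _) hc.continuousAt
    have h2 : HasDerivAt (fun s => -L * s) (-L) s := by
      simpa using (hasDerivAt_id s).const_mul (-L)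
    have h3 := h2.exp.mul h1
    have h4 : J = (fun s => Real.exp (-L * s)) * fun s => ∫ r in (0 : ℝ)..s, Real.exp (L * r) * q r :=
      funext hJe
    rw [h4]
    convert! h3 using 1
    simp only [Pi.mul_apply]
    have : Real.exp (-L * s) * (Real.exp (L * s) * q s) = q s := by
      rw [← mul_assoc, ← Real.exp_add]; simp
    rw [this]; ring
  have hJc : Continuous J := continuous_iff_continuousAt.mpr fun s => (hJd s).continuousAt
  have hprim : ∀ s ∈ uIcc 0 t, HasDerivAt (fun s => J s + Real.exp (-L * s) * A)
      (q s - L * (Real.exp (-L * s) * A + J s)) s := by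
    intro s _
    have h2 : HasDerivAt (fun s => -L * s) (-L) s := by
      simpa using (hasDerivAt_id s).const_mul (-L)
    convert! (hJd s).add (h2.exp.mul_const A) using 1
    ring
  have hint : ∫ s in (0 : ℝ)..t, heatOp d (t - s) (fun y => F (u s y)) x =
      (J t + Real.exp (-L * t) * A) - A := by
    rw [intervalIntegral.integral_congr (g := fun s => q s - L * (Real.exp (-L * s) * A + J s))
      (fun s hs => hFq s (by rwa [uIcc_of_le ht] at hs)),
      intervalIntegral.integral_eq_sub_of_hasDerivAt hprim
        ((by fun_prop : Continuous fun s => q s - L * (Real.exp (-L * s) * A + J s)).intervalIntegrable _ _)]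
    simp [hJ]
  rw [hint, h.eq t ht x]
  simp only [duhamelShift, hJ, hA, hq]
  ring

/-- Enlarging the exponent `d/2` to the integer `d` makes Bernoulli's inequality applicable. -/
theorem one_sub_rpow_le (d : ℕ) {a : ℝ} (ha : 0 < a) (ha1 : a ≤ 1) :
    1 - a ^ ((d : ℝ) / 2) ≤ d * (1 - a) := by
  have h1 : a ^ (d : ℝ) ≤ a ^ ((d : ℝ) / 2) :=
    Real.rpow_le_rpow_of_exponent_ge ha ha1 (by linarith [d.cast_nonneg (α := ℝ)])
  rw [Real.rpow_natCast] at h1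
  have h2 := one_add_mul_le_pow (a := a - 1) (by linarith) d
  rw [add_sub_cancel] at h2
  linarith

/-- Hölder continuity in time, uniformly in space, of Duhamel integrals. -/
theorem IsAdmissible.abs_integral_heatOp_sub_le (h : IsAdmissible Φ) {T C : ℝ}
    (hC : ∀ s ≤ T, ∀ y, ‖Φ s y‖ ≤ C) {s t : ℝ} (hs : 0 ≤ s) (hst : s ≤ t) (htT : t ≤ T)
    (x : EuclideanSpace ℝ (Fin d)) :
    |(∫ r in (0 : ℝ)..t, heatOp d (t - r) (Φ r) x) - ∫ r in (0 : ℝ)..s, heatOp d (s - r) (Φ r) x| ≤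
      4 * C * √(d * (t - s) * T) + C * (t - s) := by
  have hC0 : 0 ≤ C := (norm_nonneg _).trans (hC T le_rfl 0)
  rcases eq_or_lt_of_le hst with rfl | hlt
  · simp
  have hc : ∀ τ, Continuous fun r => heatOp d (τ - r) (Φ r) x := fun τ =>
    h.continuous_heatOp_comp continuous_id (by fun_prop) continuous_const
  have hi : ∀ τ a b, IntervalIntegrable (fun r => heatOp d (τ - r) (Φ r) x) volume a b :=
    fun τ a b => (hc τ).intervalIntegrable a b
  rw [← intervalIntegral.integral_add_adjacent_intervals (hi t 0 s) (hi t s t), add_sub_right_comm,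
    ← intervalIntegral.integral_sub (hi t 0 s) (hi s 0 s)]
  refine (abs_add_le _ _).trans (add_le_add ?_ ?_)
  · set K := 2 * C * √(d * (t - s)) with hK
    have hK0 : 0 ≤ K := by positivity
    have hbound : ∀ r ∈ Ioo 0 s, ‖heatOp d (t - r) (Φ r) x - heatOp d (s - r) (Φ r) x‖ ≤
        K * (1 / √(t - r)) := by
      intro r hr
      have hsr : 0 < s - r := by linarith [hr.2]
      have htr : 0 < t - r := by linarith [hr.2]
      have h1 := abs_heatOp_sub_heatOp_le (h.slice r) (hC r (by linarith [hr.2])) hsr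
        (by linarith : s - r ≤ t - r) x
      set a := (s - r) / (t - r) with ha
      have ha0 : 0 < a := by positivity
      have ha1 : a ≤ 1 := div_le_one_of_le₀ (by linarith) htr.le
      have h2 := one_sub_rpow_le d ha0 ha1
      have h3 : 0 < a ^ ((d : ℝ) / 2) := Real.rpow_pos_of_pos ha0 _
      have h3' : a ^ ((d : ℝ) / 2) ≤ 1 := Real.rpow_le_one ha0.le ha1 (by positivity)
      have h4 : 1 - a = (t - s) / (t - r) := by rw [ha]; field_simp; ring
      -- A number in `[0, 1]` is at most its square root. This weakens `(t-s)/(t-r)` to its square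
      -- root, whose integral in `r` is bounded uniformly as `s` approaches `t`, with a factor
      -- `√(t-s)` to spare.
      have h5 : 1 - a ^ ((d : ℝ) / 2) ≤ √(d * (1 - a)) := by
        refine Real.le_sqrt_of_sq_le ?_
        nlinarith
      rw [h4, ← mul_div_assoc, Real.sqrt_div' _ htr.le] at h5
      rw [Real.norm_eq_abs]
      refine h1.trans ?_
      rw [hK, mul_assoc (2 * C), ← div_eq_mul_one_div]
      exact mul_le_mul_of_nonneg_left h5 (by positivity)
    have hd : ∀ r ∈ uIcc 0 s, HasDerivAt (fun r => K * (-2 * √(t - r))) (K * (1 / √(t - r))) r := by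
      intro r hr
      rw [uIcc_of_le hs] at hr
      have htr : 0 < t - r := by linarith [hr.2]
      have h1 : HasDerivAt (fun r => t - r) (-1) r := by
        simpa using (hasDerivAt_id r).const_sub t
      have h2 := ((h1.sqrt htr.ne').const_mul (-2)).const_mul K
      convert! h2 using 1
      field_simp
    have hcont : ContinuousOn (fun r => K * (1 / √(t - r))) (uIcc 0 s) := by
      rw [uIcc_of_le hs]
      refine continuousOn_const.mul (continuousOn_const.div (by fun_prop) fun r hr => ?_)
      exact (Real.sqrt_pos.mpr (by linarith [hr.2])).ne'
    have h1 : ‖∫ r in (0 : ℝ)..s, (heatOp d (t - r) (Φ r) x - heatOp d (s - r) (Φ r) x)‖ ≤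
        ∫ r in (0 : ℝ)..s, K * (1 / √(t - r)) := by
      refine intervalIntegral.norm_integral_le_of_norm_le hs ?_ hcont.intervalIntegrable
      have hne : ∀ᵐ r : ℝ, r ≠ s := Measure.ae_ne volume s
      filter_upwards [hne] with r hr hr'
      exact hbound r ⟨hr'.1, lt_of_le_of_ne hr'.2 hr⟩
    refine h1.trans ?_
    rw [intervalIntegral.integral_eq_sub_of_hasDerivAt hd hcont.intervalIntegrable, sub_zero]
    have h2 : √t ≤ √T := Real.sqrt_le_sqrt htT
    have h3 : 0 ≤ √(t - s) := Real.sqrt_nonneg _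
    rw [Real.sqrt_mul (mul_nonneg d.cast_nonneg (by linarith))]
    have : 4 * C * (√(d * (t - s)) * √T) = K * (2 * √T) := by rw [hK]; ring
    rw [this]
    nlinarith [mul_le_mul_of_nonneg_left h2 hK0, mul_nonneg hK0 h3]
  · have h1 := intervalIntegral.norm_integral_le_of_norm_le_const (a := s) (b := t) (C := C)
      (f := fun r => heatOp d (t - r) (Φ r) x) (fun r hr => by
        rw [uIoc_of_le hst] at hr
        exact norm_heatOp_le (hC r (hr.2.trans htT)) _ _)
    rwa [abs_of_nonneg (by linarith : 0 ≤ t - s)] at h1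

/-- Norm continuity at time zero of the heat semigroup on uniformly continuous data. -/
theorem eventually_abs_heatOp_sub_le (g : EuclideanSpace ℝ (Fin d) →ᵇ ℝ)
    (hg : UniformContinuous g) {ε : ℝ} (hε : 0 < ε) :
    ∀ᶠ t in 𝓝 (0 : ℝ), ∀ x, |heatOp d t g x - g x| ≤ ε := by
  obtain ⟨δ, hδ, h⟩ := Metric.uniformContinuous_iff.mp hg (ε / 2) (by positivity)
  -- A continuous majorant of `|g(x - y) - g(x)|` independent of `x`: uniformity in `x` then follows
  -- from continuity in time of the average of `f` at one point, where `f 0 = ε / 2`.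
  set f : EuclideanSpace ℝ (Fin d) → ℝ := fun y => ε / 2 + 2 * ‖g‖ * min 1 (‖y‖ / δ) with hf
  have hfc : Continuous f := by fun_prop
  have hmin : ∀ y : EuclideanSpace ℝ (Fin d), 0 ≤ min 1 (‖y‖ / δ) := fun y =>
    le_min zero_le_one (by positivity)
  have hfb : ∀ y, ‖f y‖ ≤ ε / 2 + 2 * ‖g‖ := by
    intro y
    have h1 := hmin y
    rw [Real.norm_of_nonneg (by positivity)]
    have : 2 * ‖g‖ * min 1 (‖y‖ / δ) ≤ 2 * ‖g‖ * 1 :=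
      mul_le_mul_of_nonneg_left (min_le_left _ _) (by positivity)
    simp only [hf]
    linarith
  have hfg : ∀ x y, |g (x - y) - g x| ≤ f (0 - y) := by
    intro x y
    simp only [hf, zero_sub, norm_neg]
    by_cases hy : ‖y‖ < δ
    · have h1 := h (a := x - y) (b := x) (by simpa [dist_eq_norm] using hy)
      rw [Real.dist_eq] at h1
      have := mul_nonneg (by positivity : 0 ≤ 2 * ‖g‖) (hmin y)
      linarith
    · rw [min_eq_left ((one_le_div hδ).mpr (not_lt.mp hy))]
      have h1 : |g (x - y) - g x| ≤ |g (x - y)| + |g x| := abs_sub _ _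
      have h2 : |g (x - y)| ≤ ‖g‖ := g.norm_coe_le_norm _
      have h3 : |g x| ≤ ‖g‖ := g.norm_coe_le_norm _
      linarith
  have hc : Continuous fun t : ℝ => heatOp d t f 0 :=
    continuous_heatOp (f := fun _ => f) (by simp only [Function.uncurry_def]; fun_prop)
      (fun _ => ⟨_, Eventually.of_forall fun _ => hfb⟩) continuous_id continuous_const
  have h0 : heatOp d 0 f 0 < ε := by
    rw [heatOp_zero]; simp [hf]; exact hε
  filter_upwards [hc.continuousAt.eventually_lt continuousAt_const h0] with t ht x
  have h1 : heatOp d t g x - g x = ∫ z, (g (x - √t • z) - g x) ∂(heatMeasure d) := by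
    rw [integral_sub (integrable_comp_sub_smul g.continuous g.norm_coe_le_norm t x)
      (integrable_const _)]
    simp [heatOp]
  rw [h1]
  exact (norm_integral_le_of_norm_le (f := fun z => g (x - √t • z) - g x)
    (integrable_comp_sub_smul hfc hfb t 0)
    (Eventually.of_forall fun z => hfg x (√t • z))).trans ht.le

end

/-! ### The zeta function on the real line: signs, monotonicity, Lipschitz bounds -/

theorem riemannZeta_ofReal_im (x : ℝ) : (riemannZeta (x : ℂ)).im = 0 := by
  have h := riemannZeta_conj (x : ℂ)
  rw [Complex.conj_ofReal] at h
  exact Complex.conj_eq_iff_im.mp h.symm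

theorem ofReal_re_riemannZeta (x : ℝ) : (((riemannZeta (x : ℂ)).re : ℝ) : ℂ) = riemannZeta x :=
  Complex.ext (by simp) (by simp [riemannZeta_ofReal_im])

/-- The fractional part on `(1, ∞)`, extended by zero. -/
noncomputable def fractIoi (t : ℝ) : ℂ := (Ioi (1 : ℝ)).indicator (fun t => ((Int.fract t : ℝ) : ℂ)) t

theorem measurable_fractIoi : Measurable fractIoi :=
  (Complex.measurable_ofReal.comp measurable_fract).indicator measurableSet_Ioi

theorem norm_fractIoi_le (t : ℝ) : ‖fractIoi t‖ ≤ 1 := by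
  unfold fractIoi
  by_cases h : t ∈ Ioi (1 : ℝ)
  · rw [indicator_of_mem h, Complex.norm_real, Real.norm_of_nonneg (Int.fract_nonneg t)]
    exact (Int.fract_lt_one t).le
  · simp [indicator_of_notMem h]

theorem locallyIntegrableOn_fractIoi : LocallyIntegrableOn fractIoi (Ioi 0) := by
  have : LocallyIntegrable fractIoi := by
    refine (locallyIntegrable_const (1 : ℝ)).mono measurable_fractIoi.aestronglyMeasurable ?_
    exact Eventually.of_forall fun t => by simpa using norm_fractIoi_le t
  exact this.locallyIntegrableOn _

theorem fractIoi_isBigO_atTop : fractIoi =O[atTop] ((· ^ (-(0 : ℝ))) : ℝ → ℝ) := by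
  refine Asymptotics.IsBigO.of_bound 1 (Eventually.of_forall fun t => ?_)
  simpa using norm_fractIoi_le t

theorem fractIoi_isBigO_zero (b : ℝ) : fractIoi =O[𝓝[>] 0] ((· ^ (-b)) : ℝ → ℝ) := by
  refine Asymptotics.IsBigO.of_bound 1 ?_
  have : ∀ᶠ t : ℝ in 𝓝[>] 0, t < 1 := nhdsWithin_le_nhds (eventually_lt_nhds zero_lt_one)
  filter_upwards [this] with t ht
  have : fractIoi t = 0 := indicator_of_notMem (by simpa using ht.le) _
  simp [this]

theorem differentiableAt_mellin_fractIoi {s : ℂ} (hs : 0 < s.re) :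
    DifferentiableAt ℂ (fun s => mellin fractIoi (-s)) s := by
  have h : DifferentiableAt ℂ (mellin fractIoi) (-s) :=
    mellin_differentiableAt_of_isBigO_rpow locallyIntegrableOn_fractIoi fractIoi_isBigO_atTop
      (by simpa using hs) (fractIoi_isBigO_zero ((-s).re - 1)) (by linarith)
  exact h.comp s differentiable_neg.differentiableAt

/-- Abel summation gives `ζ(s) = s ∫₁^∞ ⌊t⌋ t^{-s-1} dt`; then `⌊t⌋ = t - {t}` is split. -/
theorem riemannZeta_eq_mellin_of_one_lt {s : ℂ} (hs : 1 < s.re) :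
    riemannZeta s = s / (s - 1) - s * mellin fractIoi (-s) := by
  have hs0 : 0 < s.re := by linarith
  have h1 : riemannZeta s =
      s * ∫ t in Ioi (1 : ℝ), (∑ k ∈ Finset.Icc 1 ⌊t⌋₊, ((1 : ℝ) : ℂ)) * (t : ℂ) ^ (-(s + 1)) := by
    rw [← LSeries_eq_mul_integral_of_nonneg (fun _ => (1 : ℝ)) zero_le_one hs ?_ (by simp)]
    · rw [← LSeries_one_eq_riemannZeta hs]
      simp [Pi.one_def]
    · refine Asymptotics.IsBigO.of_bound 1 (Eventually.of_forall fun n => ?_)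
      simp
  have h2 : mellin fractIoi (-s) =
      ∫ t in Ioi (1 : ℝ), ((Int.fract t : ℝ) : ℂ) * (t : ℂ) ^ (-(s + 1)) := by
    have : ∀ t : ℝ, (t : ℂ) ^ (-s - 1) • fractIoi t =
        (Ioi (1 : ℝ)).indicator (fun t => ((Int.fract t : ℝ) : ℂ) * (t : ℂ) ^ (-(s + 1))) t := by
      intro t
      unfold fractIoi
      by_cases h : t ∈ Ioi (1 : ℝ)
      · rw [indicator_of_mem h, indicator_of_mem h, smul_eq_mul, mul_comm, neg_add']
      · simp [indicator_of_notMem h]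
    rw [mellin]
    simp_rw [this]
    rw [setIntegral_indicator measurableSet_Ioi, Ioi_inter_Ioi]
    simp
  have h3 : IntegrableOn (fun t : ℝ => (t : ℂ) ^ (-s)) (Ioi 1) :=
    integrableOn_Ioi_cpow_of_lt (by simpa using hs) zero_lt_one
  have h4 : ∫ t in Ioi (1 : ℝ), (t : ℂ) ^ (-s) = 1 / (s - 1) := by
    rw [integral_Ioi_cpow_of_lt (by simpa using hs) zero_lt_one, Complex.ofReal_one,
      Complex.one_cpow, show -s + 1 = -(s - 1) by ring, neg_div_neg_eq]
  have h5 : IntegrableOn (fun t : ℝ => ((Int.fract t : ℝ) : ℂ) * (t : ℂ) ^ (-(s + 1))) (Ioi 1) := by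
    refine Integrable.bdd_mul (c := 1) ?_ ?_ ?_
    · exact integrableOn_Ioi_cpow_of_lt (by simp; linarith) zero_lt_one
    · exact (Complex.measurable_ofReal.comp measurable_fract).aestronglyMeasurable
    · refine Eventually.of_forall fun t => ?_
      rw [Complex.norm_real, Real.norm_of_nonneg (Int.fract_nonneg t)]
      exact (Int.fract_lt_one t).le
  rw [h1, h2, div_eq_mul_one_div, ← h4, ← mul_sub, ← integral_sub h3 h5]
  congr 1
  refine setIntegral_congr_fun measurableSet_Ioi fun t ht => ?_
  have ht : (1 : ℝ) < t := ht
  have ht0 : (t : ℂ) ≠ 0 := by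
    have : t ≠ 0 := by linarith
    exact_mod_cast this
  have h6 : (t : ℂ) ^ (-s) = t * (t : ℂ) ^ (-(s + 1)) := by
    rw [show -s = 1 + -(s + 1) by ring, Complex.cpow_add _ _ ht0, Complex.cpow_one]
  have h7 : ((⌊t⌋₊ : ℕ) : ℂ) = (t : ℂ) - ((Int.fract t : ℝ) : ℂ) := by
    rw [← Complex.ofReal_sub, Int.self_sub_fract]
    have : ((⌊t⌋₊ : ℕ) : ℝ) = ((⌊t⌋ : ℤ) : ℝ) := natCast_floor_eq_intCast_floor (by linarith)
    rw [← this]; simp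
  simp only [Finset.sum_const, Nat.card_Icc, Complex.ofReal_one, nsmul_eq_mul, mul_one,
    Nat.add_sub_cancel]
  rw [h6, h7]; ring

/-- Multiplication by `s - 1` removes the pole, so the identity theorem applies on the whole
half-plane, starting from a neighbourhood of `2`. -/
theorem riemannZeta_eq_mellin {s : ℂ} (hs : 0 < s.re) (hs1 : s ≠ 1) :
    riemannZeta s = s / (s - 1) - s * mellin fractIoi (-s) := by
  have hset : IsOpen {s : ℂ | 0 < s.re} := isOpen_lt continuous_const Complex.continuous_re
  have hA : AnalyticOnNhd ℂ riemannZeta₁ {s : ℂ | 0 < s.re} :=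
    differentiable_riemannZeta₁.differentiableOn.analyticOnNhd hset
  have hB : AnalyticOnNhd ℂ (fun s : ℂ => s - (s - 1) * (s * mellin fractIoi (-s)))
      {s : ℂ | 0 < s.re} := by
    refine DifferentiableOn.analyticOnNhd (fun z hz => ?_) hset
    have := differentiableAt_mellin_fractIoi hz
    exact (by fun_prop : DifferentiableAt ℂ
      (fun s : ℂ => s - (s - 1) * (s * mellin fractIoi (-s))) z).differentiableWithinAt
  have hev : riemannZeta₁ =ᶠ[𝓝 2]
      (fun s : ℂ => s - (s - 1) * (s * mellin fractIoi (-s))) := by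
    have : ∀ᶠ z : ℂ in 𝓝 2, 1 < z.re :=
      (isOpen_lt continuous_const Complex.continuous_re).mem_nhds (by simp)
    filter_upwards [this] with z hz
    have hz1 : z ≠ 1 := by
      rintro rfl
      simp at hz
    have h := riemannZeta_eq_mellin_of_one_lt hz
    rw [riemannZeta_eq_inv_sub_mul hz1] at h
    have hz2 : z - 1 ≠ 0 := sub_ne_zero.mpr hz1
    field_simp at h
    rw [h]; ring
  have h := hA.eqOn_of_preconnected_of_eventuallyEq hB (convex_halfSpace_re_gt 0).isPreconnected
    (z₀ := 2) (by simp) hev hs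
  have hz1 : s - 1 ≠ 0 := sub_ne_zero.mpr hs1
  rw [riemannZeta_eq_inv_sub_mul hs1, h]
  field_simp

/-- In the fractional-part formula `x / (x - 1)` is negative and the subtracted integral is
nonnegative. -/
theorem riemannZeta_re_neg_of_mem_Ioo {x : ℝ} (hx : x ∈ Ioo (0 : ℝ) 1) :
    (riemannZeta (x : ℂ)).re < 0 := by
  have hx1 : (x : ℂ) ≠ 1 := by exact_mod_cast hx.2.ne
  have hm : mellin fractIoi (-(x : ℂ)) =
      ((∫ t in Ioi (0 : ℝ), t ^ (-x - 1) * (Ioi (1 : ℝ)).indicator Int.fract t : ℝ) : ℂ) := by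
    rw [mellin, ← integral_complex_ofReal]
    refine setIntegral_congr_fun measurableSet_Ioi fun t ht => ?_
    have ht : (0 : ℝ) < t := ht
    have : fractIoi t = (((Ioi (1 : ℝ)).indicator Int.fract t : ℝ) : ℂ) := by
      unfold fractIoi
      by_cases h : t ∈ Ioi (1 : ℝ)
      · rw [indicator_of_mem h, indicator_of_mem h]
      · simp [indicator_of_notMem h]
    simp only [smul_eq_mul]
    rw [this, Complex.ofReal_mul, Complex.ofReal_cpow ht.le]
    push_cast; rfl
  have hnn : 0 ≤ ∫ t in Ioi (0 : ℝ), t ^ (-x - 1) * (Ioi (1 : ℝ)).indicator Int.fract t := by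
    refine setIntegral_nonneg measurableSet_Ioi fun t ht => ?_
    refine mul_nonneg (Real.rpow_nonneg (le_of_lt ht) _) ?_
    exact indicator_nonneg (fun t _ => Int.fract_nonneg t) t
  rw [riemannZeta_eq_mellin (by simpa using hx.1) hx1, hm]
  generalize (∫ t in Ioi (0 : ℝ), t ^ (-x - 1) * (Ioi (1 : ℝ)).indicator Int.fract t) = M at hnn
  have : ((x : ℂ) / (x - 1) - x * (M : ℂ)) = ((x / (x - 1) - x * M : ℝ) : ℂ) := by push_cast; ring
  rw [this, Complex.ofReal_re]
  have h1 : x / (x - 1) < 0 := div_neg_of_pos_of_neg hx.1 (by linarith [hx.2])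
  have := mul_nonneg hx.1.le hnn
  linarith

/-- In the functional equation all factors except the trigonometric one are evaluated at `1 - x >
1`, hence positive. -/
theorem exists_pos_riemannZeta_re_eq_mul_sin {x : ℝ} (hx : x < 0) :
    ∃ c : ℝ, 0 < c ∧ (riemannZeta (x : ℂ)).re = c * Real.sin (Real.pi * x / 2) := by
  have h1 : 1 < 1 - x := by linarith
  refine ⟨2 * (2 * Real.pi) ^ (-(1 - x)) * Real.Gamma (1 - x) * (riemannZeta ((1 - x : ℝ) : ℂ)).re,
    ?_, ?_⟩
  · have := riemannZeta_re_pos_of_one_lt h1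
    have := Real.Gamma_pos_of_pos (by linarith : 0 < 1 - x)
    positivity
  · have hne : ∀ n : ℕ, (((1 - x : ℝ)) : ℂ) ≠ -n := by
      intro n h
      have : (1 - x : ℝ) = -n := by exact_mod_cast h
      have : (0 : ℝ) ≤ n := n.cast_nonneg
      linarith
    have hne1 : (((1 - x : ℝ)) : ℂ) ≠ 1 := by
      intro h
      have : (1 - x : ℝ) = 1 := by exact_mod_cast h
      linarith
    have h := riemannZeta_one_sub hne hne1
    rw [← ofReal_re_riemannZeta (1 - x), Complex.Gamma_ofReal,
      show (1 - ((1 - x : ℝ) : ℂ)) = (x : ℂ) by push_cast; ring,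
      show (2 * (Real.pi : ℂ)) ^ (-((1 - x : ℝ) : ℂ)) = (((2 * Real.pi) ^ (-(1 - x)) : ℝ) : ℂ) by
        rw [Complex.ofReal_cpow (by positivity)]; push_cast; rfl,
      show Complex.cos (Real.pi * ((1 - x : ℝ) : ℂ) / 2) = ((Real.sin (Real.pi * x / 2) : ℝ) : ℂ) by
        rw [← Real.cos_pi_div_two_sub]; push_cast; congr 1; ring] at h
    rw [h]
    have : ∀ a b c d : ℝ, ((2 : ℂ) * a * b * c * d).re = 2 * a * b * c * d := by
      intro a b c d
      have : ((2 : ℂ) * a * b * c * d) = ((2 * a * b * c * d : ℝ) : ℂ) := by push_cast; rfl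
      rw [this, Complex.ofReal_re]
    rw [this]; ring

theorem riemannZeta_re_pos_of_mem_Ioo (n : ℕ) {x : ℝ} (hn : 1 ≤ n)
    (hx : x ∈ Ioo (-4 * (n : ℝ)) (-4 * (n : ℝ) + 2)) : 0 < (riemannZeta (x : ℂ)).re := by
  have hn' : (1 : ℝ) ≤ n := by exact_mod_cast hn
  obtain ⟨c, hc, h⟩ := exists_pos_riemannZeta_re_eq_mul_sin (x := x) (by linarith [hx.2])
  rw [h]
  refine mul_pos hc ?_
  rw [← Real.sin_add_nat_mul_two_pi _ n]
  refine Real.sin_pos_of_pos_of_lt_pi ?_ ?_ <;> nlinarith [hx.1, hx.2, Real.pi_pos]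

theorem riemannZeta_re_neg_of_mem_Ioo_neg (n : ℕ) {x : ℝ} (hn : 1 ≤ n)
    (hx : x ∈ Ioo (-4 * (n : ℝ) + 2) (-4 * (n : ℝ) + 4)) : (riemannZeta (x : ℂ)).re < 0 := by
  have hn' : (1 : ℝ) ≤ n := by exact_mod_cast hn
  obtain ⟨c, hc, h⟩ := exists_pos_riemannZeta_re_eq_mul_sin (x := x) (by linarith [hx.2])
  rw [h]
  refine mul_neg_of_pos_of_neg hc ?_
  -- After adding `2πn` the argument lies in `(π, 2π)`; one further period moves it to `(-π, 0)`.
  rw [← Real.sin_add_nat_mul_two_pi _ n, ← Real.sin_sub_two_pi]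
  refine Real.sin_neg_of_neg_of_neg_pi_lt ?_ ?_ <;> nlinarith [hx.1, hx.2, Real.pi_pos]

theorem riemannZeta_re_neg {x : ℝ} (hx : x ∈ Ioo (-2 : ℝ) 1) : (riemannZeta (x : ℂ)).re < 0 := by
  rcases lt_trichotomy x 0 with h | rfl | h
  · exact riemannZeta_re_neg_of_mem_Ioo_neg 1 le_rfl ⟨by norm_num; linarith [hx.1], by norm_num; exact h⟩
  · simp [riemannZeta_zero]; norm_num
  · exact riemannZeta_re_neg_of_mem_Ioo ⟨h, hx.2⟩

theorem riemannZeta_neg_two_mul {k : ℕ} (hk : 1 ≤ k) :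
    riemannZeta (((-2 * (k : ℝ) : ℝ)) : ℂ) = 0 := by
  obtain ⟨m, rfl⟩ := Nat.exists_eq_add_of_le' hk
  simpa using riemannZeta_neg_two_mul_nat_add_one m

theorem riemannZeta_re_eq_tsum {x : ℝ} (hx : 1 < x) :
    Summable (fun n : ℕ => 1 / ((n : ℝ) + 1) ^ x) ∧
      (riemannZeta (x : ℂ)).re = ∑' n : ℕ, 1 / ((n : ℝ) + 1) ^ x := by
  have hs : Summable (fun n : ℕ => 1 / ((n : ℝ) + 1) ^ x) := by
    have := (summable_nat_add_iff 1).mpr (Real.summable_one_div_nat_rpow.mpr hx)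
    simpa using this
  refine ⟨hs, ?_⟩
  rw [zeta_eq_tsum_one_div_nat_add_one_cpow (by simpa using hx)]
  have : ∀ n : ℕ, (1 : ℂ) / ((n : ℂ) + 1) ^ (x : ℂ) = ((1 / ((n : ℝ) + 1) ^ x : ℝ) : ℂ) := by
    intro n
    rw [Complex.ofReal_div, Complex.ofReal_cpow (by positivity)]
    push_cast; rfl
  simp_rw [this]
  rw [← Complex.ofReal_tsum, Complex.ofReal_re]

theorem one_le_riemannZeta_re {x : ℝ} (hx : 1 < x) : 1 ≤ (riemannZeta (x : ℂ)).re := by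
  obtain ⟨hs, h⟩ := riemannZeta_re_eq_tsum hx
  rw [h]
  simpa using hs.le_tsum 0 (fun n _ => by positivity)

theorem riemannZeta_re_antitone {x y : ℝ} (hx : 1 < x) (hxy : x ≤ y) :
    (riemannZeta (y : ℂ)).re ≤ (riemannZeta (x : ℂ)).re := by
  obtain ⟨hs, h⟩ := riemannZeta_re_eq_tsum hx
  obtain ⟨hs', h'⟩ := riemannZeta_re_eq_tsum (hx.trans_le hxy)
  rw [h, h']
  refine hs'.tsum_le_tsum (fun n => ?_) hs
  refine one_div_le_one_div_of_le (by positivity) ?_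
  exact Real.rpow_le_rpow_of_exponent_le (by linarith [n.cast_nonneg (α := ℝ)]) hxy

theorem norm_riemannZeta_le {z : ℂ} (hz : 1 < z.re) : ‖riemannZeta z‖ ≤ (riemannZeta (z.re : ℂ)).re := by
  obtain ⟨hs, h⟩ := riemannZeta_re_eq_tsum hz
  rw [h, zeta_eq_tsum_one_div_nat_add_one_cpow hz]
  refine tsum_of_norm_bounded hs.hasSum fun n => ?_
  rw [norm_div, norm_one, show ((n : ℂ) + 1) = (((n : ℝ) + 1 : ℝ) : ℂ) by push_cast; rfl,
    Complex.norm_cpow_eq_rpow_re_of_pos (by positivity)]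

/-- Solutions above the pole are unbounded in time, so a compact range does not suffice. Cauchy's
estimate on discs of radius `(a-1)/2` bounds the derivative, since `|ζ| ≤ ζ(a - r)` there by the
Dirichlet series. -/
theorem exists_lipschitz_riemannZeta_halfplane {a : ℝ} (ha : 1 < a) :
    ∃ L : ℝ, 0 ≤ L ∧ ∀ x y : ℝ, a ≤ x → a ≤ y →
      |(riemannZeta (x : ℂ)).re - (riemannZeta (y : ℂ)).re| ≤ L * |x - y| := by
  set r := (a - 1) / 2 with hr
  have hr0 : 0 < r := by rw [hr]; linarith
  have hb : 1 < a - r := by rw [hr]; linarith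
  set M := (riemannZeta ((a - r : ℝ) : ℂ)).re
  have hM : 0 ≤ M := zero_le_one.trans (one_le_riemannZeta_re hb)
  have hne : ∀ z : ℂ, 1 < z.re → z ≠ 1 := by rintro z hz rfl; simp at hz
  refine ⟨M / r, by positivity, fun x y hx hy => ?_⟩
  have hder : ∀ z ∈ {z : ℂ | a ≤ z.re}, ‖deriv riemannZeta z‖ ≤ M / r := by
    intro z hz
    have hz : a ≤ z.re := hz
    have hball : ∀ w ∈ Metric.closedBall z r, a - r ≤ w.re := by
      intro w hw
      have h1 : |(w - z).re| ≤ ‖w - z‖ := Complex.abs_re_le_norm _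
      have h2 : ‖w - z‖ ≤ r := by simpa [dist_eq_norm] using hw
      have h3 := abs_le.mp (h1.trans h2)
      simp only [Complex.sub_re] at h3
      linarith [h3.1]
    refine Complex.norm_deriv_le_of_forall_mem_sphere_norm_le hr0 ?_ ?_
    · refine DifferentiableOn.diffContOnCl_ball (U := Metric.closedBall z r) ?_ subset_rfl
      exact fun w hw => (differentiableAt_riemannZeta
        (hne w (hb.trans_le (hball w hw)))).differentiableWithinAt
    · intro w hw
      have := hball w (Metric.sphere_subset_closedBall hw)
      exact (norm_riemannZeta_le (hb.trans_le this)).trans (riemannZeta_re_antitone hb this)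
  have h := (convex_halfSpace_re_ge a : Convex ℝ {z : ℂ | a ≤ z.re}).norm_image_sub_le_of_norm_deriv_le (𝕜 := ℂ)
    (f := riemannZeta) (C := M / r)
    (fun z hz => differentiableAt_riemannZeta (hne z (ha.trans_le hz))) hder
    (x := (y : ℂ)) (y := (x : ℂ)) hy hx
  rw [← Complex.sub_re]
  refine (Complex.abs_re_le_norm _).trans (h.trans (le_of_eq ?_))
  rw [← Complex.ofReal_sub, Complex.norm_real, Real.norm_eq_abs]

/-- The set need not be convex, so the mean value inequality is replaced by compactness applied to
local Lipschitz bounds. -/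
theorem exists_lipschitz_riemannZeta_of_isCompact {s : Set ℂ} (hs : IsCompact s) (h1 : (1 : ℂ) ∉ s) :
    ∃ L : ℝ, 0 ≤ L ∧ ∀ z ∈ s, ∀ w ∈ s, ‖riemannZeta z - riemannZeta w‖ ≤ L * ‖z - w‖ := by
  have hloc : LocallyLipschitzOn s riemannZeta := by
    intro z hz
    have hz1 : z ≠ 1 := fun h => h1 (h ▸ hz)
    have han : AnalyticAt ℂ riemannZeta z :=
      (DifferentiableOn.analyticOnNhd (s := {(1 : ℂ)}ᶜ) (fun w hw =>
        (differentiableAt_riemannZeta hw).differentiableWithinAt) isOpen_compl_singleton) z hz1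
    obtain ⟨K, t, ht, hK⟩ := (han.contDiffAt (n := 1)).exists_lipschitzOnWith
    exact ⟨K, t, mem_nhdsWithin_of_mem_nhds ht, hK⟩
  obtain ⟨K, hK⟩ := hloc.exists_lipschitzOnWith_of_compact hs
  refine ⟨K, K.2, fun z hz w hw => ?_⟩
  simpa [dist_eq_norm] using hK.dist_le_mul z hz w hw

theorem exists_lipschitz_riemannZeta_Icc {a b : ℝ} (hb : b < 1) :
    ∃ L : ℝ, 0 ≤ L ∧ ∀ x ∈ Icc a b, ∀ y ∈ Icc a b,
      |(riemannZeta (x : ℂ)).re - (riemannZeta (y : ℂ)).re| ≤ L * |x - y| := by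
  have hc : IsCompact ((fun x : ℝ => (x : ℂ)) '' Icc a b) :=
    isCompact_Icc.image Complex.continuous_ofReal
  obtain ⟨L, hL, h⟩ := exists_lipschitz_riemannZeta_of_isCompact hc (by
    rintro ⟨x, hx, h⟩
    have : x = 1 := Complex.ofReal_injective h
    linarith [hx.2])
  refine ⟨L, hL, fun x hx y hy => ?_⟩
  have := h x ⟨x, hx, rfl⟩ y ⟨y, hy, rfl⟩
  rw [← Complex.sub_re]
  refine (Complex.abs_re_le_norm _).trans (this.trans (le_of_eq ?_))
  rw [← Complex.ofReal_sub, Complex.norm_real, Real.norm_eq_abs]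

/-! ### From real mild solutions to solutions of the zeta equation; uniqueness -/

section

variable {d : ℕ}

theorem heatOp_ofReal (τ : ℝ) (f : EuclideanSpace ℝ (Fin d) → ℝ) (x : EuclideanSpace ℝ (Fin d)) :
    heatOp d τ (fun y => (f y : ℂ)) x = ((heatOp d τ f x : ℝ) : ℂ) :=
  integral_complex_ofReal

/-- The kernel integral and the Gaussian average need not agree at `s = t`, but a single time is
negligible. -/
theorem integral_integral_heatKernel {t : ℝ} (ht : 0 ≤ t) (f : ℝ → EuclideanSpace ℝ (Fin d) → ℂ)
    (x : EuclideanSpace ℝ (Fin d)) :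
    ∫ s in (0 : ℝ)..t, ∫ y, (heatKernel d (t - s) (x - y) : ℂ) * f s y =
      ∫ s in (0 : ℝ)..t, heatOp d (t - s) (f s) x := by
  refine intervalIntegral.integral_congr_ae ?_
  have hne : ∀ᵐ r : ℝ, r ≠ t := Measure.ae_ne volume t
  filter_upwards [hne] with s hs hs'
  rw [uIoc_of_le ht] at hs'
  exact integral_heatKernel_mul_ofReal (sub_pos.mpr (lt_of_le_of_ne hs'.2 hs)) _ _

/-- A real admissible function, as a curve of complex-valued bounded continuous functions. -/
noncomputable def IsAdmissible.toBCF {u : ℝ → EuclideanSpace ℝ (Fin d) → ℝ} (h : IsAdmissible u)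
    (t : ℝ) : EuclideanSpace ℝ (Fin d) →ᵇ ℂ :=
  BoundedContinuousFunction.ofNormedAddCommGroup (fun x => (u t x : ℂ))
    (Complex.continuous_ofReal.comp (h.slice t)) (h.bounded t).choose
    (fun x => by simpa using (h.bounded t).choose_spec t le_rfl x)

theorem IsAdmissible.toBCF_apply {u : ℝ → EuclideanSpace ℝ (Fin d) → ℝ} (h : IsAdmissible u)
    (t : ℝ) (x : EuclideanSpace ℝ (Fin d)) : h.toBCF t x = (u t x : ℂ) := rfl

theorem IsAdmissible.dist_toBCF_le {u : ℝ → EuclideanSpace ℝ (Fin d) → ℝ} (h : IsAdmissible u)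
    {s t c : ℝ} (hc : ∀ x, |u s x - u t x| ≤ c) : dist (h.toBCF s) (h.toBCF t) ≤ c := by
  refine (BoundedContinuousFunction.dist_le ((abs_nonneg _).trans (hc 0))).mpr fun x => ?_
  rw [h.toBCF_apply, h.toBCF_apply, dist_eq_norm, ← Complex.ofReal_sub, Complex.norm_real]
  exact hc x

variable {F : ℝ → ℝ} {L : ℝ} {g : EuclideanSpace ℝ (Fin d) →ᵇ ℝ}
  {u : ℝ → EuclideanSpace ℝ (Fin d) → ℝ}

namespace IsShiftedMild

theorem apply_zero (h : IsShiftedMild F L g u) (x : EuclideanSpace ℝ (Fin d)) : u 0 x = g x := by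
  rw [h.eq 0 le_rfl x, heatOp_zero]
  simp [duhamelShift]

theorem continuousAt_toBCF (h : IsShiftedMild F L g u) (hL : 0 ≤ L)
    (hF : ∀ x y, |F x - F y| ≤ L * |x - y|) {t₀ : ℝ} (ht₀ : 0 < t₀) :
    ContinuousAt h.admissible.toBCF t₀ := by
  have hAdm : IsAdmissible fun s y => F (u s y) := h.admissible.comp_lipschitz hL hF
  obtain ⟨C, hC⟩ := hAdm.bounded (2 * t₀)
  -- A modulus of continuity on `[t₀/2, 2t₀]`, uniform in space: the first term controls the free
  -- evolution and degenerates as `t₀ → 0`, the second controls the Duhamel integral.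
  set ω : ℝ → ℝ := fun δ => 2 * ‖g‖ * (d * (δ / (t₀ / 2))) + (4 * C * √(d * δ * (2 * t₀)) + C * δ)
    with hω
  have key : ∀ s t, t₀ / 2 ≤ s → s ≤ t → t ≤ 2 * t₀ → ∀ x, |u t x - u s x| ≤ ω (t - s) := by
    intro s t hs hst ht x
    have hs0 : 0 < s := by linarith
    have ht0 : 0 < t := by linarith
    rw [h.duhamel hL hF ht0.le x, h.duhamel hL hF hs0.le x, add_sub_add_comm]
    refine (abs_add_le _ _).trans (add_le_add ?_
      (hAdm.abs_integral_heatOp_sub_le hC hs0.le hst ht x))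
    refine (abs_heatOp_sub_heatOp_le g.continuous g.norm_coe_le_norm hs0 hst x).trans ?_
    refine mul_le_mul_of_nonneg_left ?_ (by positivity)
    refine (one_sub_rpow_le d (by positivity) (div_le_one_of_le₀ hst ht0.le)).trans ?_
    refine mul_le_mul_of_nonneg_left ?_ d.cast_nonneg
    have : 1 - s / t = (t - s) / t := by field_simp
    rw [this]
    exact div_le_div_of_nonneg_left (by linarith) (by positivity) (by linarith)
  have hωc : Continuous ω := by fun_prop
  have hω0 : Tendsto (fun t => ω |t - t₀|) (𝓝 t₀) (𝓝 0) := by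
    have : Continuous fun t => ω |t - t₀| := by fun_prop
    refine this.tendsto' t₀ 0 ?_
    simp [hω]
  refine tendsto_iff_dist_tendsto_zero.mpr (squeeze_zero' (Eventually.of_forall fun _ => dist_nonneg)
    ?_ hω0)
  filter_upwards [Ioo_mem_nhds (by linarith : t₀ / 2 < t₀) (by linarith : t₀ < 2 * t₀)] with t ht
  refine h.admissible.dist_toBCF_le fun x => ?_
  rcases le_total t t₀ with htt | htt
  · rw [abs_sub_comm, abs_sub_comm t]
    rw [abs_of_nonneg (by linarith : 0 ≤ t₀ - t)]
    exact key t t₀ ht.1.le htt (by linarith) x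
  · rw [abs_of_nonneg (by linarith : 0 ≤ t - t₀)]
    exact key t₀ t (by linarith) htt ht.2.le x

theorem continuousOn_toBCF (h : IsShiftedMild F L g u) (hL : 0 ≤ L)
    (hF : ∀ x y, |F x - F y| ≤ L * |x - y|) (hg : UniformContinuous g) :
    ContinuousOn h.admissible.toBCF (Ici 0) := by
  intro t₀ ht₀
  rcases eq_or_lt_of_le (show (0 : ℝ) ≤ t₀ from ht₀) with rfl | hpos
  · have hAdm : IsAdmissible fun s y => F (u s y) := h.admissible.comp_lipschitz hL hF
    obtain ⟨C, hC⟩ := hAdm.bounded 1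
    refine Metric.continuousWithinAt_iff'.mpr fun ε hε => ?_
    have h1 := nhdsWithin_le_nhds (s := Ici 0)
      (eventually_abs_heatOp_sub_le g hg (by positivity : 0 < ε / 3))
    have h2 : ∀ᶠ t : ℝ in 𝓝[≥] 0, C * t < ε / 3 := by
      have : Continuous fun t : ℝ => C * t := by fun_prop
      exact nhdsWithin_le_nhds (this.continuousAt.eventually_lt continuousAt_const
        (by simpa using by positivity))
    have h3 : ∀ᶠ t : ℝ in 𝓝[≥] 0, t ≤ 1 := nhdsWithin_le_nhds (eventually_le_nhds zero_lt_one)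
    filter_upwards [h1, h2, h3, self_mem_nhdsWithin] with t ht1 ht2 ht3 ht0
    have ht0 : (0 : ℝ) ≤ t := ht0
    refine lt_of_le_of_lt (h.admissible.dist_toBCF_le (c := ε / 3 + ε / 3) fun x => ?_) (by linarith)
    rw [h.apply_zero, h.duhamel hL hF ht0 x, add_sub_right_comm]
    refine (abs_add_le _ _).trans (add_le_add (ht1 x) ?_)
    have h4 := intervalIntegral.norm_integral_le_of_norm_le_const (a := 0) (b := t) (C := C)
      (f := fun r => heatOp d (t - r) (fun y => F (u r y)) x) (fun r hr => by
        rw [uIoc_of_le ht0] at hr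
        exact norm_heatOp_le (hC r (hr.2.trans ht3)) _ _)
    rw [sub_zero, abs_of_nonneg ht0] at h4
    exact h4.trans ht2.le
  · exact (h.continuousAt_toBCF hL hF hpos).continuousWithinAt

theorem isZetaHeatSolution (h : IsShiftedMild F L g u) (hL : 0 ≤ L)
    (hF : ∀ x y, |F x - F y| ≤ L * |x - y|)
    (hζ : ∀ t, 0 ≤ t → ∀ x, F (u t x) = (riemannZeta (u t x : ℂ)).re) {ε : ℝ} (hε : 0 < ε)
    (haway : ∀ t, 0 ≤ t → ∀ x, ε ≤ |u t x - 1|) (T : ℝ) :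
    IsZetaHeatSolution (complexify g) T h.admissible.toBCF where
  initial := by
    ext x
    rw [h.admissible.toBCF_apply, h.apply_zero]
    rfl
  continuousOn := fun t ht => (h.continuousAt_toBCF hL hF ht.1).continuousWithinAt
  tendsto_initial := by
    rw [tendstoLocallyUniformly_iff_forall_tendsto]
    intro x
    refine Tendsto.mono_right ?_ (nhds_le_uniformity (complexify g x))
    rw [nhds_prod_eq]
    refine Tendsto.prodMk ?_ ?_
    · exact ((complexify g).continuous.tendsto x).comp tendsto_snd
    · have h1 : Tendsto (fun p : ℝ × EuclideanSpace ℝ (Fin d) => ((u p.1 p.2 : ℝ) : ℂ)) (𝓝 (0, x))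
          (𝓝 ((u 0 x : ℝ) : ℂ)) :=
        (Complex.continuous_ofReal.comp h.admissible.continuous).tendsto (0, x)
      rw [h.apply_zero] at h1
      refine h1.mono_left ?_
      rw [nhds_prod_eq]
      exact Filter.prod_mono nhdsWithin_le_nhds le_rfl
  bounded_and_away := by
    intro T' _
    obtain ⟨C, hC⟩ := h.admissible.bounded T'
    refine ⟨C, ε, hε, fun t ht x => ⟨?_, ?_⟩⟩
    · rw [h.admissible.toBCF_apply, Complex.norm_real]
      exact hC t ht.2 x
    · rw [h.admissible.toBCF_apply, ← Complex.ofReal_one, ← Complex.ofReal_sub, Complex.norm_real]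
      exact haway t ht.1 x
  duhamel := by
    intro t ht x
    rw [integral_integral_heatKernel ht.1.le (fun s y => riemannZeta (h.admissible.toBCF s y)),
      integral_heatKernel_mul_ofReal ht.1, h.admissible.toBCF_apply, h.duhamel hL hF ht.1.le x,
      Complex.ofReal_add, ← heatOp_ofReal, ← intervalIntegral.integral_ofReal]
    congr 1
    refine intervalIntegral.integral_congr fun s hs => ?_
    rw [uIcc_of_le ht.1.le] at hs
    rw [← heatOp_ofReal]
    congr 1
    ext y
    rw [h.admissible.toBCF_apply, hζ s hs.1, ofReal_re_riemannZeta]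

end IsShiftedMild

theorem isCompact_norm_le_le_norm_sub_one (β ε : ℝ) :
    IsCompact {z : ℂ | ‖z‖ ≤ β ∧ ε ≤ ‖z - 1‖} := by
  refine (isCompact_closedBall (0 : ℂ) β).of_isClosed_subset ?_ fun z hz => by simpa using hz.1
  exact (isClosed_le continuous_norm continuous_const).inter
    (isClosed_le (f := fun _ : ℂ => ε) (g := fun z : ℂ => ‖z - 1‖) continuous_const (by fun_prop))

/-- The integrand of Duhamel's formula along a solution is integrable in time. -/
theorem IsZetaHeatSolution.integrableOn {g : EuclideanSpace ℝ (Fin d) →ᵇ ℂ} {T : ℝ}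
    {v : ℝ → (EuclideanSpace ℝ (Fin d) →ᵇ ℂ)} (hv : IsZetaHeatSolution g T v) {t : ℝ}
    (ht : t ∈ Ioo 0 T) (x : EuclideanSpace ℝ (Fin d)) :
    IntegrableOn (fun s => heatOp d (t - s) (fun y => riemannZeta (v s y)) x) (Ioo 0 t) := by
  obtain ⟨β, ε, hε, hb⟩ := hv.bounded_and_away t ht.2
  have hK := isCompact_norm_le_le_norm_sub_one β ε
  have hζc : ContinuousOn riemannZeta {z : ℂ | ‖z‖ ≤ β ∧ ε ≤ ‖z - 1‖} := by
    intro z hz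
    refine (differentiableAt_riemannZeta ?_).continuousAt.continuousWithinAt
    rintro rfl
    have := hz.2
    simp at this
    linarith
  obtain ⟨M, hM⟩ := hK.exists_bound_of_continuousOn hζc
  have hM' : ∀ s ∈ Ioo 0 t, ∀ y, ‖riemannZeta (v s y)‖ ≤ M := fun s hs y =>
    hM _ (hb s ⟨hs.1.le, hs.2.le⟩ y)
  have hcont : ContinuousOn (fun s => heatOp d (t - s) (fun y => riemannZeta (v s y)) x)
      (Ioo 0 t) := by
    rw [continuousOn_iff_continuous_domRestrict]
    refine continuous_heatOp (X := Ioo 0 t) (f := fun s y => riemannZeta (v s y)) ?_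
      (fun s₀ => ⟨M, Eventually.of_forall fun s y => hM' s s.2 y⟩) (by fun_prop) continuous_const
    have hvc : Continuous fun s : Ioo 0 t => v s :=
      continuousOn_iff_continuous_domRestrict.mp
        (hv.continuousOn.mono (Ioo_subset_Ioo_right ht.2.le))
    have hvc2 : Continuous fun p : Ioo 0 t × EuclideanSpace ℝ (Fin d) => v p.1 p.2 :=
      continuous_eval.comp ((hvc.comp continuous_fst).prodMk continuous_snd)
    exact hζc.comp_continuous hvc2 fun p => hb p.1 ⟨p.1.2.1.le, p.1.2.2.le⟩ p.2
  refine Integrable.of_bound (hcont.aestronglyMeasurable measurableSet_Ioo) M ?_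
  exact ae_restrict_of_forall_mem measurableSet_Ioo fun s hs => norm_heatOp_le (hM' s hs) _ _

/-- Up to time `t` both solutions take values in one compact set avoiding the pole, where `ζ` is
Lipschitz; a weighted bound on the difference then halves at each pass through Duhamel's formula. -/
theorem IsZetaHeatSolution.eq_of_mem_Ico {g : EuclideanSpace ℝ (Fin d) →ᵇ ℂ} {T : ℝ}
    {v w : ℝ → (EuclideanSpace ℝ (Fin d) →ᵇ ℂ)} (hv : IsZetaHeatSolution g T v)
    (hw : IsZetaHeatSolution g T w) {t : ℝ} (ht : t ∈ Ico 0 T) : v t = w t := by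
  obtain ⟨β, ε, hε, hb⟩ := hv.bounded_and_away t ht.2
  obtain ⟨β', ε', hε', hb'⟩ := hw.bounded_and_away t ht.2
  set K : Set ℂ := {z : ℂ | ‖z‖ ≤ max β β' ∧ min ε ε' ≤ ‖z - 1‖} with hKdef
  have hK : IsCompact K := isCompact_norm_le_le_norm_sub_one _ _
  have h1K : (1 : ℂ) ∉ K := by
    intro h
    have := h.2
    rw [sub_self, norm_zero] at this
    exact absurd (lt_min hε hε') (not_lt.mpr this)
  obtain ⟨L, hL, hLip⟩ := exists_lipschitz_riemannZeta_of_isCompact hK h1K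
  have hvK : ∀ s ∈ Icc 0 t, ∀ y, v s y ∈ K := fun s hs y =>
    ⟨(hb s hs y).1.trans (le_max_left _ _), (min_le_left _ _).trans (hb s hs y).2⟩
  have hwK : ∀ s ∈ Icc 0 t, ∀ y, w s y ∈ K := fun s hs y =>
    ⟨(hb' s hs y).1.trans (le_max_right _ _), (min_le_right _ _).trans (hb' s hs y).2⟩
  have hζc : ContinuousOn riemannZeta K := fun z hz =>
    (differentiableAt_riemannZeta (fun h => h1K (h ▸ hz))).continuousAt.continuousWithinAt
  obtain ⟨M, hM⟩ := hK.exists_bound_of_continuousOn hζc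
  -- This gives `L / lam ≤ 1/2`; the summand `1` keeps `lam` positive when `L = 0`.
  set lam : ℝ := 2 * L + 1 with hlam
  have hlam0 : 0 < lam := by positivity
  have hstep : ∀ m, 0 ≤ m → (∀ s ∈ Icc 0 t, ∀ y, ‖v s y - w s y‖ ≤ m * Real.exp (lam * s)) →
      ∀ s ∈ Icc 0 t, ∀ y, ‖v s y - w s y‖ ≤ m / 2 * Real.exp (lam * s) := by
    intro m hm hle s hs y
    rcases eq_or_lt_of_le hs.1 with rfl | hs0
    · rw [hv.initial, hw.initial, sub_self, norm_zero]; positivity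
    have hsT : s ∈ Ioo 0 T := ⟨hs0, hs.2.trans_lt ht.2⟩
    have hcv : ∀ r ∈ Icc 0 s, Continuous fun z => riemannZeta (v r z) := fun r hr =>
      hζc.comp_continuous (v r).continuous (hvK r ⟨hr.1, hr.2.trans hs.2⟩)
    have hcw : ∀ r ∈ Icc 0 s, Continuous fun z => riemannZeta (w r z) := fun r hr =>
      hζc.comp_continuous (w r).continuous (hwK r ⟨hr.1, hr.2.trans hs.2⟩)
    have hdiff : v s y - w s y = ∫ r in Ioo 0 s,
        heatOp d (s - r) (fun z => riemannZeta (v r z) - riemannZeta (w r z)) y := by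
      rw [hv.duhamel s hsT y, hw.duhamel s hsT y, add_sub_add_left_eq_sub,
        integral_integral_heatKernel hs.1 (fun s y => riemannZeta (v s y)),
        integral_integral_heatKernel hs.1 (fun s y => riemannZeta (w s y)),
        intervalIntegral.integral_of_le hs.1, intervalIntegral.integral_of_le hs.1,
        integral_Ioc_eq_integral_Ioo, integral_Ioc_eq_integral_Ioo,
        ← integral_sub (hv.integrableOn hsT y) (hw.integrableOn hsT y)]
      refine setIntegral_congr_fun measurableSet_Ioo fun r hr => ?_
      have hr' : r ∈ Icc 0 s := ⟨hr.1.le, hr.2.le⟩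
      have hrt : r ∈ Icc 0 t := ⟨hr.1.le, hr.2.le.trans hs.2⟩
      exact (heatOp_sub (hcv r hr') (hcw r hr') (fun z => hM _ (hvK r hrt z))
        (fun z => hM _ (hwK r hrt z)) _ _).symm
    have hexpc : Continuous fun r => L * m * Real.exp (lam * r) := by fun_prop
    have hnorm : ‖v s y - w s y‖ ≤ ∫ r in Ioo 0 s, L * m * Real.exp (lam * r) := by
      rw [hdiff]
      refine norm_integral_le_of_norm_le
        (hexpc.integrableOn_Icc.mono_set Ioo_subset_Icc_self) ?_
      refine ae_restrict_of_forall_mem measurableSet_Ioo fun r hr => ?_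
      have hrt : r ∈ Icc 0 t := ⟨hr.1.le, hr.2.le.trans hs.2⟩
      refine norm_heatOp_le (fun z => ?_) _ _
      refine (hLip _ (hvK r hrt z) _ (hwK r hrt z)).trans ?_
      rw [mul_assoc]
      exact mul_le_mul_of_nonneg_left (hle r hrt z) hL
    rw [← integral_Ioc_eq_integral_Ioo, ← intervalIntegral.integral_of_le hs.1] at hnorm
    refine hnorm.trans ((integral_exp_mul_le hlam0 (by positivity) s).trans ?_)
    refine mul_le_mul_of_nonneg_right ?_ (Real.exp_pos _).le
    rw [div_le_div_iff₀ hlam0 two_pos, hlam]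
    nlinarith
  have hiter : ∀ n : ℕ, ∀ s ∈ Icc 0 t, ∀ y,
      ‖v s y - w s y‖ ≤ (2 * max β β') * (1 / 2) ^ n * Real.exp (lam * s) := by
    have hβ : 0 ≤ max β β' := (norm_nonneg _).trans (hvK 0 ⟨le_rfl, ht.1⟩ 0).1
    intro n
    induction n with
    | zero =>
      intro s hs y
      have h1 := (norm_sub_le _ _).trans (add_le_add (hvK s hs y).1 (hwK s hs y).1)
      have h3 : 1 ≤ Real.exp (lam * s) := Real.one_le_exp (mul_nonneg hlam0.le hs.1)
      rw [pow_zero, mul_one]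
      nlinarith
    | succ n ih =>
      intro s hs y
      refine (hstep _ (by positivity) ih s hs y).trans (le_of_eq ?_)
      rw [pow_succ]; ring
  ext x
  have hlim : Tendsto (fun n : ℕ => (2 * max β β') * (1 / 2 : ℝ) ^ n * Real.exp (lam * t)) atTop
      (𝓝 0) := by
    have := ((tendsto_pow_atTop_nhds_zero_of_lt_one (by norm_num : (0 : ℝ) ≤ 1 / 2)
      (by norm_num)).const_mul (2 * max β β')).mul_const (Real.exp (lam * t))
    simpa using this
  have := ge_of_tendsto' hlim fun n => hiter n t ⟨ht.1, le_rfl⟩ x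
  exact sub_eq_zero.mp (norm_le_zero_iff.mp this)

end

/-! ### Barriers at the trivial zeros -/

theorem isGreatest_lowerTrivialZero (I : ℝ) :
    IsGreatest {z : ℝ | (∃ k : ℕ, 1 ≤ k ∧ z = -2 * (k : ℝ)) ∧ z ≤ I} (lowerTrivialZero I) := by
  have h : IsGreatest {z : ℝ | (∃ k : ℕ, 1 ≤ k ∧ z = -2 * (k : ℝ)) ∧ z ≤ I}
      -- The condition `-2k ≤ I` means `k ≥ -I/2`; the maximum with `1` enforces `k ≥ 1` when `I >
      -- -2`.
      (-2 * ((max 1 ⌈-I / 2⌉₊ : ℕ) : ℝ)) := by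
    refine ⟨⟨⟨_, le_max_left _ _, rfl⟩, ?_⟩, ?_⟩
    · have h1 : -I / 2 ≤ (⌈-I / 2⌉₊ : ℝ) := Nat.le_ceil _
      have h2 : (⌈-I / 2⌉₊ : ℝ) ≤ ((max 1 ⌈-I / 2⌉₊ : ℕ) : ℝ) := by
        exact_mod_cast le_max_right _ _
      linarith
    · rintro z ⟨⟨k, hk, rfl⟩, hz⟩
      have h1 : ⌈-I / 2⌉₊ ≤ k := Nat.ceil_le.mpr (by linarith)
      have h2 : ((max 1 ⌈-I / 2⌉₊ : ℕ) : ℝ) ≤ k := by exact_mod_cast max_le hk h1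
      linarith
  rw [lowerTrivialZero, h.csSup_eq]
  exact h

theorem isLeast_upperBarrier {S : ℝ} (hS : S ≤ -2) :
    IsLeast {z : ℝ | (∃ k : ℕ, 1 ≤ k ∧ z = -2 * (k : ℝ)) ∧ S ≤ z} (upperBarrier S) := by
  have h : IsLeast {z : ℝ | (∃ k : ℕ, 1 ≤ k ∧ z = -2 * (k : ℝ)) ∧ S ≤ z}
      (-2 * ((⌊-S / 2⌋₊ : ℕ) : ℝ)) := by
    refine ⟨⟨⟨_, Nat.le_floor (by push_cast; linarith), rfl⟩, ?_⟩, ?_⟩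
    · have h1 : (⌊-S / 2⌋₊ : ℝ) ≤ -S / 2 := Nat.floor_le (by linarith)
      linarith
    · rintro z ⟨⟨k, hk, rfl⟩, hz⟩
      have h1 : k ≤ ⌊-S / 2⌋₊ := Nat.le_floor (by linarith)
      have h2 : (k : ℝ) ≤ (⌊-S / 2⌋₊ : ℝ) := by exact_mod_cast h1
      linarith
  rw [upperBarrier, if_pos hS, h.csInf_eq]
  exact h

theorem upperBarrier_of_neg_two_lt {S : ℝ} (hS : -2 < S) : upperBarrier S = S :=
  if_neg (not_le.mpr hS)

theorem le_upperBarrier (S : ℝ) : S ≤ upperBarrier S := by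
  rcases le_or_gt S (-2) with h | h
  · exact (isLeast_upperBarrier h).1.2
  · exact (upperBarrier_of_neg_two_lt h).ge

theorem upperBarrier_lt_one {S : ℝ} (hS : S < 1) : upperBarrier S < 1 := by
  rcases le_or_gt S (-2) with h | h
  · obtain ⟨⟨⟨k, -, hk⟩, -⟩, -⟩ := isLeast_upperBarrier h
    rw [hk]
    linarith [k.cast_nonneg (α := ℝ)]
  · rwa [upperBarrier_of_neg_two_lt h]

/-- The barrier is either a trivial zero or lies in `(-2, 1)`, where `ζ` is negative; hence it is a
constant supersolution. -/
theorem riemannZeta_upperBarrier_re_nonpos {S : ℝ} (hS : S < 1) :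
    (riemannZeta (upperBarrier S : ℂ)).re ≤ 0 := by
  rcases le_or_gt S (-2) with h | h
  · obtain ⟨⟨⟨k, hk1, hk⟩, -⟩, -⟩ := isLeast_upperBarrier h
    rw [hk, riemannZeta_neg_two_mul hk1, Complex.zero_re]
  · rw [upperBarrier_of_neg_two_lt h]
    exact (riemannZeta_re_neg ⟨h, hS⟩).le

theorem riemannZeta_lowerTrivialZero (I : ℝ) : riemannZeta (lowerTrivialZero I : ℂ) = 0 := by
  obtain ⟨⟨⟨k, hk1, hk⟩, -⟩, -⟩ := isGreatest_lowerTrivialZero I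
  rw [hk, riemannZeta_neg_two_mul hk1]

theorem exists_neg_four_mul_add_two {n : ℕ} (hn : 1 ≤ n) :
    ∃ k : ℕ, 1 ≤ k ∧ -4 * (n : ℝ) + 2 = -2 * (k : ℝ) := by
  refine ⟨2 * n - 1, by omega, ?_⟩
  rw [Nat.cast_sub (by omega)]
  push_cast; ring

/-- This and `le_upperBarrier_of_lt` keep the attracting zero inside the interval on which the
truncated nonlinearity equals `ζ`. -/
theorem lowerTrivialZero_le_of_lt {I : ℝ} {n : ℕ} (h : I < -4 * (n : ℝ) + 4) :
    lowerTrivialZero I ≤ -4 * (n : ℝ) + 2 := by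
  obtain ⟨⟨⟨k, -, hk⟩, hle⟩, -⟩ := isGreatest_lowerTrivialZero I
  rw [hk] at hle ⊢
  have h1 : 2 * (n : ℝ) < k + 2 := by linarith
  have h2 : 2 * n < k + 2 := by exact_mod_cast h1
  have h3 : 2 * n ≤ k + 1 := by omega
  have h4 : 2 * (n : ℝ) ≤ k + 1 := by exact_mod_cast h3
  linarith

theorem le_upperBarrier_of_lt {S : ℝ} {n : ℕ} (hn : 1 ≤ n) (h : -4 * (n : ℝ) < S) :
    -4 * (n : ℝ) + 2 ≤ upperBarrier S := by
  rcases le_or_gt S (-2) with hS | hS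
  · obtain ⟨⟨⟨k, -, hk⟩, hle⟩, -⟩ := isLeast_upperBarrier hS
    rw [hk] at hle ⊢
    have h1 : (k : ℝ) < 2 * n := by linarith
    have h2 : k < 2 * n := by exact_mod_cast h1
    have h3 : k + 1 ≤ 2 * n := by omega
    have h4 : (k : ℝ) + 1 ≤ 2 * n := by exact_mod_cast h3
    linarith
  · rw [upperBarrier_of_neg_two_lt hS]
    have : (1 : ℝ) ≤ n := by exact_mod_cast hn
    linarith

theorem limsup_coe_le_of_eventually_le {f : ℝ → ℝ} {z : ℝ}
    (h : ∀ η > 0, ∀ᶠ t in atTop, f t ≤ z + η) :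
    limsup (fun t => (f t : EReal)) atTop ≤ (z : EReal) := by
  refine EReal.le_of_forall_lt_iff_le.mp fun y hy => ?_
  have hy' : z < y := EReal.coe_lt_coe_iff.mp hy
  refine limsup_le_of_le (by isBoundedDefault) ?_
  filter_upwards [h (y - z) (sub_pos.mpr hy')] with t ht
  exact EReal.coe_le_coe_iff.mpr (by linarith)

theorem le_liminf_coe_of_eventually_le {f : ℝ → ℝ} {z : ℝ}
    (h : ∀ η > 0, ∀ᶠ t in atTop, z - η ≤ f t) :
    (z : EReal) ≤ liminf (fun t => (f t : EReal)) atTop := by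
  refine EReal.ge_of_forall_gt_iff_ge.mp fun y hy => ?_
  have hy' : y < z := EReal.coe_lt_coe_iff.mp hy
  refine le_liminf_of_le (by isBoundedDefault) ?_
  filter_upwards [h (z - y) (sub_pos.mpr hy')] with t ht
  exact EReal.coe_le_coe_iff.mpr (by linarith)

/-! ### Long-time behaviour -/

section

variable {d : ℕ} {F : ℝ → ℝ} {L : ℝ} {g : EuclideanSpace ℝ (Fin d) →ᵇ ℝ}
  {u : ℝ → EuclideanSpace ℝ (Fin d) → ℝ}

/-- If the reaction term is negative on `(z, S]`, solutions starting below `S` are asymptotically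
below `z`. -/
theorem IsShiftedMild.eventually_le_add (h : IsShiftedMild F L g u) (hL : 0 < L)
    (hF : ∀ x y, |F x - F y| ≤ L * |x - y|) {z S : ℝ} (hzS : z < S) (hS : ∀ x, g x ≤ S)
    (hneg : ∀ y ∈ Ioc z S, F y < 0) {η : ℝ} (hη : 0 < η) :
    ∀ᶠ t in atTop, ∀ x, u t x ≤ z + η := by
  have hFc : Continuous F := by
    refine (LipschitzWith.of_dist_le_mul (K := L.toNNReal) fun x y => ?_).continuous
    simpa [Real.dist_eq, hL.le] using hF x y
  set ε := min (η / 2) (S - z) with hε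
  have hε0 : 0 < ε := lt_min (by positivity) (by linarith)
  have hε1 : ε ≤ η / 2 := min_le_left _ _
  have hε2 : ε ≤ S - z := min_le_right _ _
  obtain ⟨y₀, hy₀, hmax⟩ := (isCompact_Icc (a := z + ε) (b := S)).exists_isMaxOn
    ⟨S, by linarith, le_rfl⟩ hFc.continuousOn
  have hδ : 0 < -F y₀ := neg_pos.mpr (hneg y₀ ⟨by linarith [hy₀.1], hy₀.2⟩)
  set m := S - z - ε with hm
  have hm0 : 0 ≤ m := by linarith
  -- The rate is small enough that `c m ≤ -F y₀`; dividing by `m + 1` allows `m = 0`.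
  set c := -F y₀ / (m + 1) with hc
  have hc0 : 0 < c := by positivity
  have hcm : c * m ≤ -F y₀ := by
    rw [hc, div_mul_eq_mul_div, div_le_iff₀ (by linarith)]
    nlinarith
  -- The barrier starts at `S`, stays in `[z + ε, S]`, and has slope at least `-c m ≥ F y₀`, the
  -- maximum of `F` there.
  have hle : ∀ t, 0 ≤ t → ∀ x, u t x ≤ z + ε + m * Real.exp (-c * t) := by
    intro t ht x
    refine h.le_of_supersolution hL hF (φ := fun t => z + ε + m * Real.exp (-c * t))
      (φ' := fun t => m * (Real.exp (-c * t) * -c)) (fun t => ?_) (by fun_prop) (fun x => ?_)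
      (fun t ht => ?_) ht x
    · have h2 : HasDerivAt (fun s => -c * s) (-c) t := by
        simpa using (hasDerivAt_id t).const_mul (-c)
      exact (h2.exp.const_mul m).const_add (z + ε)
    · simp only [mul_zero, Real.exp_zero, mul_one]
      linarith [hS x]
    · have he : Real.exp (-c * t) ≤ 1 := Real.exp_le_one_iff.mpr (by nlinarith)
      have he0 := Real.exp_pos (-c * t)
      have hmem : z + ε + m * Real.exp (-c * t) ∈ Icc (z + ε) S :=
        ⟨by nlinarith, by nlinarith⟩
      have h1 : F (z + ε + m * Real.exp (-c * t)) ≤ F y₀ := hmax hmem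
      have h2 : c * m * Real.exp (-c * t) ≤ c * m := mul_le_of_le_one_right (by positivity) he
      linarith
  have hlim : Tendsto (fun t => z + ε + m * Real.exp (-c * t)) atTop (𝓝 (z + ε)) := by
    have h1 : Tendsto (fun t : ℝ => -c * t) atTop atBot :=
      tendsto_id.const_mul_atTop_of_neg (neg_neg_of_pos hc0)
    have h2 := ((Real.tendsto_exp_atBot.comp h1).const_mul m).const_add (z + ε)
    simpa using h2
  filter_upwards [hlim.eventually_lt_const (by linarith : z + ε < z + η), eventually_ge_atTop 0]
    with t ht ht0 x
  exact (hle t ht0 x).trans ht.le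

/-- If the reaction term is positive on `[I, z)`, solutions starting above `I` are asymptotically
above `z`. -/
theorem IsShiftedMild.eventually_sub_le (h : IsShiftedMild F L g u) (hL : 0 < L)
    (hF : ∀ x y, |F x - F y| ≤ L * |x - y|) {z I : ℝ} (hzI : I < z) (hI : ∀ x, I ≤ g x)
    (hpos : ∀ y ∈ Ico I z, 0 < F y) {η : ℝ} (hη : 0 < η) :
    ∀ᶠ t in atTop, ∀ x, z - η ≤ u t x := by
  have := h.neg.eventually_le_add hL (z := -z) (S := -I) (fun x y => by
      have := hF (-x) (-y)
      rwa [← abs_neg, show -x - -y = -(x - y) by ring, abs_neg (x - y),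
        show -(F (-x) - F (-y)) = -F (-x) - -F (-y) by ring] at this)
    (by linarith) (fun x => by simpa using hI x)
    (fun y hy => neg_neg_of_pos (hpos (-y) ⟨by linarith [hy.2], by linarith [hy.1]⟩)) hη
  filter_upwards [this] with t ht x
  linarith [ht x]

end

/-! ### Truncated nonlinearities on either side of the pole, and the theorem -/

theorem exists_zeta_mild_of_one_lt {d : ℕ} (g : EuclideanSpace ℝ (Fin d) →ᵇ ℝ) {I S : ℝ}
    (hI1 : 1 < I) (hI : ∀ x, I ≤ g x) (hS : ∀ x, g x ≤ S) :
    ∃ F : ℝ → ℝ, ∃ L : ℝ, ∃ u : ℝ → EuclideanSpace ℝ (Fin d) → ℝ, 0 < L ∧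
      (∀ x y, |F x - F y| ≤ L * |x - y|) ∧ IsShiftedMild F L g u ∧
      (∀ t, 0 ≤ t → ∀ x, F (u t x) = (riemannZeta (u t x : ℂ)).re) ∧
      (∀ t, 0 ≤ t → ∀ x, I - 1 ≤ |u t x - 1|) ∧
      ∀ t, 0 ≤ t → ∀ x, t + I ≤ u t x ∧ u t x ≤ (riemannZeta (I : ℂ)).re * t + S := by
  obtain ⟨L, hL, hLip⟩ := exists_lipschitz_riemannZeta_halfplane hI1
  -- This `F` takes values in `[1, ζ(I)]`, so both affine barriers apply; the lower one gives `u ≥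
  -- I`, which makes the truncation invisible.
  set F : ℝ → ℝ := fun x => (riemannZeta ((max x I : ℝ) : ℂ)).re with hFdef
  have hF : ∀ x y, |F x - F y| ≤ (L + 1) * |x - y| := by
    intro x y
    have h1 := hLip (max x I) (max y I) (le_max_right _ _) (le_max_right _ _)
    have h2 : |max x I - max y I| ≤ |x - y| := abs_max_sub_max_le_abs x y I
    refine h1.trans ?_
    nlinarith [abs_nonneg (x - y), abs_nonneg (max x I - max y I)]
  have hL1 : 0 < L + 1 := by linarith
  obtain ⟨u, hu⟩ := exists_isShiftedMild hL1 hF g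
  have hlow : ∀ t, 0 ≤ t → ∀ x, t + I ≤ u t x := fun t ht x =>
    hu.ge_of_subsolution hL1 hF (φ := fun t => t + I) (φ' := fun _ => 1)
      (fun t => (hasDerivAt_id t).add_const I) continuous_const (fun x => by simpa using hI x)
      (fun t _ => one_le_riemannZeta_re (hI1.trans_le (le_max_right _ _))) ht x
  have hup : ∀ t, 0 ≤ t → ∀ x, u t x ≤ (riemannZeta (I : ℂ)).re * t + S := fun t ht x =>
    hu.le_of_supersolution hL1 hF (φ := fun t => (riemannZeta (I : ℂ)).re * t + S)
      (φ' := fun _ => (riemannZeta (I : ℂ)).re)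
      (fun t => by simpa using ((hasDerivAt_id t).const_mul (riemannZeta (I : ℂ)).re).add_const S)
      continuous_const (fun x => by simpa using hS x)
      (fun t _ => riemannZeta_re_antitone hI1 (le_max_right _ _)) ht x
  refine ⟨F, L + 1, u, hL1, hF, hu, fun t ht x => ?_, fun t ht x => ?_,
    fun t ht x => ⟨hlow t ht x, hup t ht x⟩⟩
  · rw [hFdef]
    simp only
    rw [max_eq_left (by linarith [hlow t ht x])]
  · exact le_trans (by linarith [hlow t ht x]) (le_abs_self _)

theorem exists_zeta_mild_of_lt_one {d : ℕ} (g : EuclideanSpace ℝ (Fin d) →ᵇ ℝ) {I S : ℝ}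
    (hS1 : S < 1) (hI : ∀ x, I ≤ g x) (hS : ∀ x, g x ≤ S) :
    ∃ F : ℝ → ℝ, ∃ L : ℝ, ∃ u : ℝ → EuclideanSpace ℝ (Fin d) → ℝ, 0 < L ∧
      (∀ x y, |F x - F y| ≤ L * |x - y|) ∧ IsShiftedMild F L g u ∧
      (∀ y ∈ Icc (lowerTrivialZero I) (upperBarrier S), F y = (riemannZeta (y : ℂ)).re) ∧
      ∀ t, 0 ≤ t → ∀ x, u t x ∈ Icc (lowerTrivialZero I) (upperBarrier S) := by
  set a := lowerTrivialZero I with ha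
  set b := upperBarrier S with hb
  have haI : a ≤ I := (isGreatest_lowerTrivialZero I).1.2
  have hSb : S ≤ b := le_upperBarrier S
  have hab : a ≤ b := by linarith [hI 0, hS 0]
  obtain ⟨L, hL, hLip⟩ := exists_lipschitz_riemannZeta_Icc (a := a) (upperBarrier_lt_one hS1)
  -- Projection onto `[a, b]` makes `F` globally Lipschitz; `F a = 0` and `F b ≤ 0` then keep the
  -- solution in `[a, b]`.
  set F : ℝ → ℝ := fun x => (riemannZeta ((max a (min x b) : ℝ) : ℂ)).re with hFdef
  have hmem : ∀ x, max a (min x b) ∈ Icc a b := fun x =>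
    ⟨le_max_left _ _, max_le hab (min_le_right _ _)⟩
  have hFeq : ∀ y ∈ Icc a b, F y = (riemannZeta (y : ℂ)).re := by
    intro y hy
    rw [hFdef]
    simp only
    rw [min_eq_left hy.2, max_eq_right hy.1]
  have hF : ∀ x y, |F x - F y| ≤ (L + 1) * |x - y| := by
    intro x y
    have h1 := hLip _ (hmem x) _ (hmem y)
    have h2 : |max a (min x b) - max a (min y b)| ≤ |x - y| := by
      rw [max_comm a, max_comm a]
      refine (abs_max_sub_max_le_abs _ _ _).trans ?_
      simpa using abs_min_sub_min_le_max x b y b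
    refine h1.trans ?_
    nlinarith [abs_nonneg (x - y), abs_nonneg (max a (min x b) - max a (min y b))]
  have hL1 : 0 < L + 1 := by linarith
  obtain ⟨u, hu⟩ := exists_isShiftedMild hL1 hF g
  refine ⟨F, L + 1, u, hL1, hF, hu, hFeq, fun t ht x => ⟨?_, ?_⟩⟩
  · refine hu.ge_of_subsolution hL1 hF (φ := fun _ => a) (φ' := fun _ => 0)
      (fun t => hasDerivAt_const t a) continuous_const (fun x => haI.trans (hI x)) (fun t _ => ?_) ht x
    rw [hFeq a ⟨le_rfl, hab⟩, ha, riemannZeta_lowerTrivialZero, Complex.zero_re]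
  · refine hu.le_of_supersolution hL1 hF (φ := fun _ => b) (φ' := fun _ => 0)
      (fun t => hasDerivAt_const t b) continuous_const (fun x => (hS x).trans hSb) (fun t _ => ?_) ht x
    rw [hFeq b ⟨hab, le_rfl⟩, hb]
    exact riemannZeta_upperBarrier_re_nonpos hS1

/-- A continuous real function on a connected space keeping a positive distance from `1` stays on
one side of `1`. -/
theorem forall_one_add_le_or_forall_le_one_sub {X : Type*} [TopologicalSpace X]
    [PreconnectedSpace X] {f : X → ℝ} (hf : Continuous f) {δ : ℝ} (hδ : 0 < δ)
    (h : ∀ x, δ ≤ |f x - 1|) : (∀ x, 1 + δ ≤ f x) ∨ ∀ x, f x ≤ 1 - δ := by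
  by_contra! hcon
  obtain ⟨⟨x, hx⟩, y, hy⟩ := hcon
  have hx1 : f x ≤ 1 := by
    by_contra hgt
    have := h x
    rw [abs_of_nonneg (by linarith)] at this
    linarith
  have hy1 : 1 ≤ f y := by
    by_contra hlt
    have := h y
    rw [abs_of_nonpos (by linarith)] at this
    linarith
  obtain ⟨z, hz⟩ := mem_range_of_exists_le_of_exists_ge hf ⟨x, hx1⟩ ⟨y, hy1⟩
  have := h z
  rw [hz, sub_self, abs_zero] at this
  linarith

theorem theorem1p3 (d : ℕ) (hd : 1 ≤ d) (g : EuclideanSpace ℝ (Fin d) →ᵇ ℝ)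
    (hg : 0 < ⨅ x, |g x - 1|) (I S : ℝ) (hI : I = ⨅ x, g x) (hS : S = ⨆ x, g x) :
    ∃ u : ℝ → (EuclideanSpace ℝ (Fin d) →ᵇ ℂ),
      -- `u` is a global solution
      (∀ T : ℝ, 0 < T → IsZetaHeatSolution (complexify g) T u) ∧
      -- it extends every local solution
      (∀ (T : ℝ) (v : ℝ → (EuclideanSpace ℝ (Fin d) →ᵇ ℂ)), 0 < T →
        IsZetaHeatSolution (complexify g) T v → ∀ t ∈ Ico 0 T, v t = u t) ∧
      -- it is norm continuous up to `t = 0` when the datum allows it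
      (UniformContinuous g → ContinuousOn u (Ici 0)) ∧
      -- it is real-valued
      (∀ t : ℝ, 0 ≤ t → ∀ x, (u t x).im = 0) ∧
      -- (i)
      (1 < I → ∀ t : ℝ, 0 ≤ t → ∀ x,
        t + I ≤ (u t x).re ∧ (u t x).re ≤ (riemannZeta (I : ℂ)).re * t + S) ∧
      -- (ii)
      (I < 1 → ∀ t : ℝ, 0 ≤ t → ∀ x,
        lowerTrivialZero I ≤ (u t x).re ∧ (u t x).re ≤ upperBarrier S) ∧
      -- (iii)
      (I < 1 → ∀ n₁ n₂ : ℕ, 1 ≤ n₁ → 1 ≤ n₂ →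
        I ∈ Ioo (-4 * (n₁ : ℝ)) (-4 * (n₁ : ℝ) + 4) →
        S ∈ Ioo (-4 * (n₂ : ℝ)) (-4 * (n₂ : ℝ) + 4) → ∀ x,
        ((-4 * (n₁ : ℝ) + 2 : ℝ) : EReal) ≤ liminf (fun t : ℝ => ((u t x).re : EReal)) atTop ∧
        liminf (fun t : ℝ => ((u t x).re : EReal)) atTop ≤
          limsup (fun t : ℝ => ((u t x).re : EReal)) atTop ∧
        limsup (fun t : ℝ => ((u t x).re : EReal)) atTop ≤ ((-4 * (n₂ : ℝ) + 2 : ℝ) : EReal)) := by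
  have hbelow : BddBelow (range g) := ⟨-‖g‖, by
    rintro _ ⟨x, rfl⟩
    exact neg_le_of_abs_le (g.norm_coe_le_norm x)⟩
  have habove : BddAbove (range g) := ⟨‖g‖, by
    rintro _ ⟨x, rfl⟩
    exact le_of_abs_le (g.norm_coe_le_norm x)⟩
  have hIle : ∀ x, I ≤ g x := fun x => hI ▸ ciInf_le hbelow x
  have hleS : ∀ x, g x ≤ S := fun x => hS ▸ le_ciSup habove x
  have hdist : ∀ x, (⨅ x, |g x - 1|) ≤ |g x - 1| := fun x =>
    ciInf_le ⟨0, by rintro _ ⟨x, rfl⟩; exact abs_nonneg _⟩ x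
  rcases forall_one_add_le_or_forall_le_one_sub g.continuous hg hdist with hside | hside
  · have hI1 : 1 < I := by
      rw [hI]
      exact lt_of_lt_of_le (by linarith) (le_ciInf hside)
    obtain ⟨F, L, u, hL, hF, hu, hζ, haway, hbd⟩ := exists_zeta_mild_of_one_lt g hI1 hIle hleS
    have hsol := hu.isZetaHeatSolution hL.le hF hζ (sub_pos.mpr hI1) haway
    refine ⟨hu.admissible.toBCF, fun T _ => hsol T, fun T v _ hv t ht => hv.eq_of_mem_Ico (hsol T) ht,
      hu.continuousOn_toBCF hL.le hF, fun t _ x => Complex.ofReal_im _, fun _ t ht x => hbd t ht x,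
      fun h => absurd h (not_lt.mpr hI1.le), fun h => absurd h (not_lt.mpr hI1.le)⟩
  · have hS1 : S < 1 := by
      rw [hS]
      exact lt_of_le_of_lt (ciSup_le hside) (by linarith)
    have hIS : I ≤ S := (hIle 0).trans (hleS 0)
    obtain ⟨F, L, u, hL, hF, hu, hFζ, hbd⟩ := exists_zeta_mild_of_lt_one g hS1 hIle hleS
    have hb1 := upperBarrier_lt_one hS1
    have hsol := hu.isZetaHeatSolution hL.le hF (fun t ht x => hFζ _ (hbd t ht x))
      (sub_pos.mpr hb1) (fun t ht x => by
        rw [abs_sub_comm]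
        exact le_trans (by linarith [(hbd t ht x).2]) (le_abs_self _))
    refine ⟨hu.admissible.toBCF, fun T _ => hsol T, fun T v _ hv t ht => hv.eq_of_mem_Ico (hsol T) ht,
      hu.continuousOn_toBCF hL.le hF, fun t _ x => Complex.ofReal_im _,
      fun h => absurd h (not_lt.mpr (by linarith)), fun _ t ht x => hbd t ht x, ?_⟩
    intro _ n₁ n₂ hn₁ hn₂ hIn hSn x
    refine ⟨le_liminf_coe_of_eventually_le fun η hη => ?_, liminf_le_limsup,
      limsup_coe_le_of_eventually_le fun η hη => ?_⟩
    -- If `-4n₁ + 2 ≤ I`, this trivial zero competes in the maximum defining `lowerTrivialZero I`,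
    -- so the bound holds at all times. Otherwise `ζ > 0` on `[I, -4n₁ + 2)` and the solution is
    -- driven up.
    · rcases le_or_gt (-4 * (n₁ : ℝ) + 2) I with hle | hlt
      · have h1 := (isGreatest_lowerTrivialZero I).2 ⟨exists_neg_four_mul_add_two hn₁, hle⟩
        filter_upwards [eventually_ge_atTop 0] with t ht
        exact le_trans (by linarith) (hbd t ht x).1
      · refine (hu.eventually_sub_le hL hF hlt hIle (fun y hy => ?_) hη).mono fun t ht => ht x
        rw [hFζ y ⟨(isGreatest_lowerTrivialZero I).1.2.trans hy.1,
          hy.2.le.trans (le_upperBarrier_of_lt hn₁ (hIn.1.trans_le hIS))⟩]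
        exact riemannZeta_re_pos_of_mem_Ioo n₁ hn₁ ⟨hIn.1.trans_le hy.1, hy.2⟩
    -- Symmetrically: either the zero competes in the minimum defining `upperBarrier S`, or `ζ < 0`
    -- on `(-4n₂ + 2, S]`.
    · rcases le_or_gt S (-4 * (n₂ : ℝ) + 2) with hle | hlt
      · have hn : (1 : ℝ) ≤ n₂ := by exact_mod_cast hn₂
        have h1 := (isLeast_upperBarrier (by linarith : S ≤ -2)).2
          ⟨exists_neg_four_mul_add_two hn₂, hle⟩
        filter_upwards [eventually_ge_atTop 0] with t ht
        exact le_trans (hbd t ht x).2 (by linarith)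
      · refine (hu.eventually_le_add hL hF hlt hleS (fun y hy => ?_) hη).mono fun t ht => ht x
        rw [hFζ y ⟨(lowerTrivialZero_le_of_lt (hIS.trans_lt hSn.2)).trans hy.1.le,
          hy.2.trans (le_upperBarrier S)⟩]
        exact riemannZeta_re_neg_of_mem_Ioo_neg n₂ hn₂ ⟨hy.1, hy.2.trans_lt hSn.2⟩
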